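/- Consider a $K$-tier uplink millimetre-wave network with maximum user transmit power $P_u>0$, noise power $\sigma^2\ge 0$, and, for tier $k=1,\dots,K$: density $\lambda_k>0$, blockage parameter $\beta_k>0$, cutoff threshold $\rho_o^k>0$, SINR threshold $\theta_k>0$, LOS and NLOS path-loss exponents $\alpha_L^k,\alpha_N^k>0$, base-station (BS) antenna gains $G_{bk}^{\max},G_{bk}^{\min}>0$ and beamwidth $\zeta_{rk}\in[0,2\pi]$; users have antenna gains $G_u^{\max},G_u^{\min}>0$ and beamwidth $\zeta_t\in[0,2\pi]$. A tier-$k$ link of length $r$ is LOS with probability $e^{-\beta_k r}$ and NLOS otherwise, independently over links. All fading power gains are Gamma distributed with shape $N$ and rate $N$ (Nakagami fading), $N\ge1$ an integer. Transmit powers: around a typical user at the origin the BSs of tier $k$ form independent homogeneous Poisson processes (PPPs) of density $\lambda_k$; a BS of tier $k$ at $x$ has path loss $\|x\|^{\alpha}$ with $\alpha=\alpha_L^k$ or $\alpha_N^k$ according to whether the link is LOS or NLOS, and $m$ denotes the smallest path loss over all BSs of all tiers. The transmit power $P_k$ of a typical active user of tier $k$ has the law of $\rho_o^k m$ conditioned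 on $\rho_o^k m\le P_u$. Interference: fix a tier $j$ and a reference BS of this tier at the origin; let $\mathcal G_j=G_{bj}^{\max}G_u^{\max}$. The interfering users $z$ of tier $k$, at positions $u_z$, form a homogeneous PPP of density $\lambda_k$, independently over tiers, with i.i.d. transmit powers $P_z$ distributed as $P_k$, i.i.d. Gamma fading $|g_z|^2$, i.i.d. directivity gains $G_z$ equal to $a_v^j$ with probability $b_v^j$ ($v=1,\dots,4$), where $(a^j_1,\dots,a^j_4)=(G_{bj}^{\max}G_u^{\max},\,G_{bj}^{\max}G_u^{\min},\,G_{bj}^{\min}G_u^{\max},\,G_{bj}^{\min}G_u^{\min})$ and, with $x=\frac{\zeta_{rj}}{2\pi}$, $t=\frac{\zeta_t}{2\pi}$, $(b_1^j,\dots,b_4^j)=(xt,\,x(1-t),\,(1-x)t,\,(1-x)(1-t))$; all of these and the desired fading $|g_o|^2$ are independent. Put $$I=\sum_{k=1}^K\sum_{z\text{ in tier }k}\mathbf 1\big(P_z\|u_z\|^{-\alpha_z}<\rho_o^k\big)\,P_zG_z|g_z|^2\|u_z\|^{-\alpha_z}\in[0,\infty],\qquad SINR_j=\frac{\rho_o^j|g_o|^2\mathcal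 G_j}{\sigma^2+I},$$ with $\alpha_z=\alpha_L^j$ with probability $e^{-\beta_j\|u_z\|}$ and $\alpha_z=\alpha_N^j$ otherwise. Let $\eta=N(N!)^{-1/N}$, and let $$\mathcal O_s^j=\mathbb E\Big[\Big(1-e^{-\eta\theta_j(\sigma^2+I)/(\rho_o^j\mathcal G_j)}\Big)^N\Big]$$ be the SINR outage probability obtained from $\mathbb P(SINR_j\le\theta_j)$ by approximating the distribution function of $|g_o|^2$ by $x\mapsto(1-e^{-\eta x})^N$. Then, with $e^{-\infty}=0$, $$\mathcal O_s^j=1-\sum_{n=1}^N(-1)^{n+1}\binom Nn\exp\Big(-\frac{\eta n\theta_j\sigma^2}{\rho_o^j\mathcal G_j}-\sum_{k=1}^K(Q_n^k+V_n^k)\Big),$$ where $Q_n^k,V_n^k\in[0,\infty]$ are $$Q_n^k=2\pi\lambda_k\sum_{v=1}^4 b_v^j (q_v^j)^{2/\alpha_L^j}\int_{\mathcal A_j}^\infty\!\int_0^{P_u}\mathcal F\Big(N,\tfrac{y^{-\alpha_L^j}}N\Big)e^{-\beta_j(q_v^jp)^{1/\alpha_L^j}y}\,y\,p^{2/\alpha_L^j}f_{P_k}(p)\,dp\,dy,$$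 $$V_n^k=2\pi\lambda_k\sum_{v=1}^4 b_v^j (q_v^j)^{2/\alpha_N^j}\int_{\mathcal B_j}^\infty\!\int_0^{P_u}\mathcal F\Big(N,\tfrac{y^{-\alpha_N^j}}N\Big)\Big(1-e^{-\beta_j(q_v^jp)^{1/\alpha_N^j}y}\Big)\,y\,p^{2/\alpha_N^j}f_{P_k}(p)\,dp\,dy,$$ $q_v^j=\frac{\eta n\theta_ja_v^j}{\rho_o^j\mathcal G_j}$, $\mathcal A_j=(q_v^j\rho_o^k)^{-1/\alpha_L^j}$, $\mathcal B_j=(q_v^j\rho_o^k)^{-1/\alpha_N^j}$, $\mathcal F(N,y)=1-(1+y)^{-N}$, and $$f_{P_k}(p)=\frac{\sum_{a=1}^K\overline\lambda_a(p)}{1-e^{-\sum_a\Lambda_a(P_u/\rho_o^k)}}\,e^{-\sum_a\Lambda_a(p/\rho_o^k)},$$ $$\overline\lambda_a(p)=\frac{2\pi\lambda_a\,p^{\frac2{\alpha_L^a}-1}}{\alpha_L^a(\rho_o^k)^{2/\alpha_L^a}}e^{-\beta_a(p/\rho_o^k)^{1/\alpha_L^a}}+\frac{2\pi\lambda_a\,p^{\frac2{\alpha_N^a}-1}}{\alpha_N^a(\rho_o^k)^{2/\alpha_N^a}}\Big(1-e^{-\beta_a(p/\rho_o^k)^{1/\alpha_N^a}}\Big),$$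 $$\Lambda_a(y)=\frac{2\pi\lambda_a}{\beta_a^2}\Big(h_a\big(y^{1/\alpha_L^a}\big)-h_a\big(y^{1/\alpha_N^a}\big)\Big)+\pi\lambda_a y^{2/\alpha_N^a},\qquad h_a(r)=1-e^{-\beta_a r}(1+\beta_a r).$$ Moreover $\mathcal O_s^j\le\mathbb P(SINR_j\le\theta_j)$, with equality if $N=1$. -/

import Mathlib

open MeasureTheory ProbabilityTheory
open scoped ENNReal NNReal Nat

noncomputable section

namespace MmWave

/-- The Euclidean plane. -/
abbrev Plane : Type := EuclideanSpace ℝ (Fin 2)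

/-! ### Network parameters -/

/-- Parameters of a `K`-tier uplink millimetre-wave network. -/
structure Network (K : ℕ) where
  /-- Nakagami fading parameter (a positive integer) -/
  N : ℕ
  /-- maximum transmit power of a user -/
  Pu : ℝ
  /-- noise standard deviation: the noise power is `σ ^ 2` -/
  σ : ℝ
  /-- main lobe gain of a user antenna -/
  GuMax : ℝ
  /-- side lobe gain of a user antenna -/
  GuMin : ℝ
  /-- beamwidth of a user antenna -/
  ζt : ℝ
  /-- density of the base stations of each tier -/
  lam : Fin K → ℝ
  /-- blockage parameter of each tier -/
  β : Fin K → ℝ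
  /-- power control cutoff threshold of each tier -/
  ρ : Fin K → ℝ
  /-- main lobe gain of the base station antennas of each tier -/
  GbMax : Fin K → ℝ
  /-- side lobe gain of the base station antennas of each tier -/
  GbMin : Fin K → ℝ
  /-- beamwidth of the base station antennas of each tier -/
  ζr : Fin K → ℝ
  /-- LOS path loss exponent of each tier -/
  αL : Fin K → ℝ
  /-- NLOS path loss exponent of each tier -/
  αN : Fin K → ℝ
  /-- SINR threshold of each tier -/
  θ : Fin K → ℝ
  N_pos : 0 < N
  Pu_pos : 0 < Pu
  σ_nonneg : 0 ≤ σ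
  GuMax_pos : 0 < GuMax
  GuMin_pos : 0 < GuMin
  ζt_mem : ζt ∈ Set.Icc 0 (2 * Real.pi)
  lam_pos : ∀ k, 0 < lam k
  β_pos : ∀ k, 0 < β k
  ρ_pos : ∀ k, 0 < ρ k
  GbMax_pos : ∀ k, 0 < GbMax k
  GbMin_pos : ∀ k, 0 < GbMin k
  ζr_mem : ∀ k, ζr k ∈ Set.Icc 0 (2 * Real.pi)
  αL_pos : ∀ k, 0 < αL k
  αN_pos : ∀ k, 0 < αN k
  θ_pos : ∀ k, 0 < θ k

namespace Network

variable {K : ℕ} (net : Network K)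

/-- Directivity gain of the desired link in tier `j`. -/
def G (j : Fin K) : ℝ := net.GbMax j * net.GuMax

/-- The four possible directivity gains `a_v^j` of an interfering link. -/
def a (j : Fin K) : Fin 4 → ℝ :=
  ![net.GbMax j * net.GuMax, net.GbMax j * net.GuMin,
    net.GbMin j * net.GuMax, net.GbMin j * net.GuMin]

/-- The probabilities `b_v^j` of the four directivity gains. -/
def b (j : Fin K) : Fin 4 → ℝ :=
  ![net.ζr j * net.ζt / (4 * Real.pi ^ 2),
    net.ζr j / (2 * Real.pi) * (1 - net.ζt / (2 * Real.pi)),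
    (1 - net.ζr j / (2 * Real.pi)) * (net.ζt / (2 * Real.pi)),
    (1 - net.ζr j / (2 * Real.pi)) * (1 - net.ζt / (2 * Real.pi))]

/-- Law of the directivity gain of an interfering link at a base station of tier `j`. -/
def gainLaw (j : Fin K) : Measure ℝ :=
  ∑ v : Fin 4, ENNReal.ofReal (net.b j v) • Measure.dirac (net.a j v)

/-- Law of the small-scale power gain `|g|²` of a Nakagami fading link: the Gamma law with shape
`N` and rate `N` (mean one). -/
def fadingLaw : Measure ℝ := gammaMeasure (net.N : ℝ) (net.N : ℝ)

end Network

/-! ### Poisson point processes -/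

/-- Number of points of the sequence `X` that lie in `A`. -/
def count {Ω E : Type*} (X : ℕ → Ω → E) (A : Set E) (ω : Ω) : ℝ≥0∞ :=
  ∑' i, A.indicator (fun _ => (1 : ℝ≥0∞)) (X i ω)

/-- The random points `X 0, X 1, …` enumerate a Poisson point process with intensity measure `Λ`:
the number of points in a set of finite intensity is Poisson, and the numbers of points in disjoint
sets are independent. -/
structure IsPoissonProcess {Ω E : Type*} [MeasurableSpace Ω] [MeasurableSpace E]
    (X : ℕ → Ω → E) (Λ : Measure E) (P : Measure Ω) : Prop where
  measurable : ∀ i, Measurable (X i)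
  poisson : ∀ A : Set E, MeasurableSet A → Λ A ≠ ∞ → ∀ n : ℕ,
    P {ω | count X A ω = n} = poissonMeasure (Λ A).toNNReal {n}
  indep : ∀ (m : ℕ) (A : Fin m → Set E), (∀ i, MeasurableSet (A i)) →
    Pairwise (fun i i' => Disjoint (A i) (A i')) → iIndepFun (fun i => count X (A i)) P

/-- A homogeneous Poisson point process of density `d` in the plane. -/
def IsHomogeneousPPP {Ω : Type*} [MeasurableSpace Ω] (X : ℕ → Ω → Plane) (d : ℝ)
    (P : Measure Ω) : Prop :=
  IsPoissonProcess X (ENNReal.ofReal d • volume) P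

/-- The uniform law on the unit interval. -/
def uniformLaw : Measure ℝ := volume.restrict (Set.Icc (0 : ℝ) 1)

/-- A link of length `r` is LOS, in an environment with blockage parameter `β`, if its blockage
variable `u` (uniform on `[0, 1]`) is at most `exp (-β r)`; this has probability `exp (-β r)`. -/
def IsLOS (β r u : ℝ) : Prop := u ≤ Real.exp (-β * r)

/-! ### Base stations around a typical user, and the transmit power -/

/-- The base stations of the `K` tiers seen from a typical user at the origin. -/
structure BaseStations (K : ℕ) (Ω : Type*) where
  /-- positions of the base stations of each tier -/
  loc : Fin K → ℕ → Ω → Plane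
  /-- blockage variables of the links to these base stations -/
  blk : Fin K → ℕ → Ω → ℝ

/-- Labels of the independent sources of randomness of `BaseStations`. -/
inductive BSSource (K : ℕ) where
  | loc (k : Fin K)
  | blk (k : Fin K) (i : ℕ)

namespace BaseStations

variable {K : ℕ} {Ω : Type*} (bs : BaseStations K Ω)

/-- The σ-algebra generated by a source of randomness. -/
@[reducible]
def sigma : BSSource K → MeasurableSpace Ω
  | .loc k => ⨆ i, MeasurableSpace.comap (bs.loc k i) inferInstance
  | .blk k i => MeasurableSpace.comap (bs.blk k i) inferInstance

/-- The base stations of tier `k` form a homogeneous Poisson process of density `lam k`, the links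
are blocked independently, and everything is independent across tiers. -/
structure IsModel [MeasurableSpace Ω] (net : Network K) (P : Measure Ω) : Prop where
  loc_ppp : ∀ k, IsHomogeneousPPP (bs.loc k) (net.lam k) P
  blk_meas : ∀ k i, Measurable (bs.blk k i)
  blk_law : ∀ k i, P.map (bs.blk k i) = uniformLaw
  indep : iIndep bs.sigma P

open Classical in
/-- Path loss `‖x‖ ^ α` of the link to the `i`-th base station of tier `k`, where `α` is the LOS or
the NLOS exponent of that tier. -/
def loss (net : Network K) (k : Fin K) (i : ℕ) (ω : Ω) : ℝ :=
  if IsLOS (net.β k) ‖bs.loc k i ω‖ (bs.blk k i ω) then ‖bs.loc k i ω‖ ^ net.αL k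
  else ‖bs.loc k i ω‖ ^ net.αN k

/-- Path loss to the serving base station: the smallest path loss over all tiers. -/
def minLoss (net : Network K) (ω : Ω) : ℝ := ⨅ q : Fin K × ℕ, bs.loss net q.1 q.2 ω

/-- Power that a user of tier `k` needs for inverting the path loss to its serving base station. -/
def power (net : Network K) (k : Fin K) (ω : Ω) : ℝ := net.ρ k * bs.minLoss net ω

/-- Law of the transmit power of a typical active user of tier `k` under truncated channel
inversion: the conditional law of the required power, given that it is at most `Pu`. -/
def powerLaw [MeasurableSpace Ω] (net : Network K) (P : Measure Ω) (k : Fin K) : Measure ℝ :=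
  (P[|{ω | bs.power net k ω ≤ net.Pu}]).map (bs.power net k)

end BaseStations

/-! ### The uplink at the reference base station -/

/-- The interfering users of the `K` tiers, seen from a reference base station at the origin, and
the fading of the desired link. -/
structure Uplink (K : ℕ) (Ω : Type*) where
  /-- power gain `|g_o|²` of the desired link -/
  desired : Ω → ℝ
  /-- positions of the interfering users of each tier -/
  loc : Fin K → ℕ → Ω → Plane
  /-- their transmit powers -/
  pow : Fin K → ℕ → Ω → ℝ
  /-- small-scale power gains `|g_z|²` of the interfering links -/
  fad : Fin K → ℕ → Ω → ℝ
  /-- directivity gains of the interfering links -/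
  dir : Fin K → ℕ → Ω → ℝ
  /-- blockage variables of the interfering links -/
  blk : Fin K → ℕ → Ω → ℝ

/-- Labels of the independent sources of randomness of `Uplink`. -/
inductive ULSource (K : ℕ) where
  | desired
  | loc (k : Fin K)
  | pow (k : Fin K) (i : ℕ)
  | fad (k : Fin K) (i : ℕ)
  | dir (k : Fin K) (i : ℕ)
  | blk (k : Fin K) (i : ℕ)

namespace Uplink

variable {K : ℕ} {Ω : Type*} (up : Uplink K Ω)

/-- The σ-algebra generated by a source of randomness. -/
@[reducible]
def sigma : ULSource K → MeasurableSpace Ω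
  | .desired => MeasurableSpace.comap up.desired inferInstance
  | .loc k => ⨆ i, MeasurableSpace.comap (up.loc k i) inferInstance
  | .pow k i => MeasurableSpace.comap (up.pow k i) inferInstance
  | .fad k i => MeasurableSpace.comap (up.fad k i) inferInstance
  | .dir k i => MeasurableSpace.comap (up.dir k i) inferInstance
  | .blk k i => MeasurableSpace.comap (up.blk k i) inferInstance

/-- The Poisson and independent-power model of the uplink at a reference base station of tier `j`:
the interfering users of tier `k` form a homogeneous Poisson process of density `lam k`, their
transmit powers are independent with law `powerLaw k`, and locations, powers, fading, directivity
gains and blockages are all independent. -/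
structure IsModel [MeasurableSpace Ω] (net : Network K) (j : Fin K)
    (powerLaw : Fin K → Measure ℝ) (P : Measure Ω) : Prop where
  desired_meas : Measurable up.desired
  desired_law : P.map up.desired = net.fadingLaw
  loc_ppp : ∀ k, IsHomogeneousPPP (up.loc k) (net.lam k) P
  pow_meas : ∀ k i, Measurable (up.pow k i)
  pow_law : ∀ k i, P.map (up.pow k i) = powerLaw k
  fad_meas : ∀ k i, Measurable (up.fad k i)
  fad_law : ∀ k i, P.map (up.fad k i) = net.fadingLaw
  dir_meas : ∀ k i, Measurable (up.dir k i)
  dir_law : ∀ k i, P.map (up.dir k i) = net.gainLaw j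
  blk_meas : ∀ k i, Measurable (up.blk k i)
  blk_law : ∀ k i, P.map (up.blk k i) = uniformLaw
  indep : iIndep up.sigma P

open Classical in
/-- Power received from the `i`-th interfering user of tier `k` through a link with path loss
exponent `α`. It only counts if the average received power `P ‖x‖ ^ (-α)` is below `ρ k`
(otherwise the user would not be served by its own tier-`k` base station). -/
def received (net : Network K) (k : Fin K) (α : ℝ) (i : ℕ) (ω : Ω) : ℝ≥0∞ :=
  if up.pow k i ω * ‖up.loc k i ω‖ ^ (-α) < net.ρ k then
    ENNReal.ofReal
      (up.pow k i ω * up.dir k i ω * up.fad k i ω * ‖up.loc k i ω‖ ^ (-α))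
  else 0

open Classical in
/-- Aggregate interference `I_L^k` at the reference base station (of tier `j`) from the LOS users of
tier `k`. -/
def interferenceL (net : Network K) (j k : Fin K) (ω : Ω) : ℝ≥0∞ :=
  ∑' i, if IsLOS (net.β j) ‖up.loc k i ω‖ (up.blk k i ω) then
    up.received net k (net.αL j) i ω else 0

open Classical in
/-- Aggregate interference `I_N^k` at the reference base station (of tier `j`) from the NLOS users
of tier `k`. -/
def interferenceN (net : Network K) (j k : Fin K) (ω : Ω) : ℝ≥0∞ :=
  ∑' i, if IsLOS (net.β j) ‖up.loc k i ω‖ (up.blk k i ω) then 0 else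
    up.received net k (net.αN j) i ω

/-- Noise plus total interference. -/
def noiseInterference (net : Network K) (j : Fin K) (ω : Ω) : ℝ≥0∞ :=
  ENNReal.ofReal (net.σ ^ 2) +
    ∑ k, up.interferenceL net j k ω + ∑ k, up.interferenceN net j k ω

/-- The signal-to-interference-and-noise ratio at the reference base station. -/
def sinr (net : Network K) (j : Fin K) (ω : Ω) : ℝ≥0∞ :=
  ENNReal.ofReal (net.ρ j * up.desired ω * net.G j) / up.noiseInterference net j ω

/-- The SINR outage probability `P (SINR_j ≤ θ_j)`. -/
def outage [MeasurableSpace Ω] (net : Network K) (j : Fin K) (P : Measure Ω) : ℝ :=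
  P.real {ω | up.sinr net j ω ≤ ENNReal.ofReal (net.θ j)}

end Uplink

/-! ### The approximate outage probability and the closed form -/

/-- `exp (-x)` for `x ∈ [0, ∞]`, with `exp (-∞) = 0`. -/
def expNeg (x : ℝ≥0∞) : ℝ := if x = ∞ then 0 else Real.exp (-x.toReal)

/-- `η = N (N!) ^ (-1/N)`. -/
def eta (N : ℕ) : ℝ := (N : ℝ) * (N ! : ℝ) ^ (-(1 / (N : ℝ)))

/-- The function `x ↦ (1 - exp (-η x)) ^ N` on `[0, ∞]`, which approximates the distribution
function of the Gamma law with shape and rate `N`. -/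
def approxFadingCDF (N : ℕ) (x : ℝ≥0∞) : ℝ :=
  (1 - expNeg (ENNReal.ofReal (eta N) * x)) ^ N

/-- The SINR outage probability of tier `j`, with the distribution function of the fading of the
desired link replaced by `approxFadingCDF`. -/
def Uplink.approxOutage {K : ℕ} {Ω : Type*} [MeasurableSpace Ω] (up : Uplink K Ω)
    (net : Network K) (j : Fin K) (P : Measure Ω) : ℝ :=
  ∫ ω, approxFadingCDF net.N
    (ENNReal.ofReal (net.θ j / (net.ρ j * net.G j)) * up.noiseInterference net j ω) ∂P

/-- `F (N, y) = 1 - 1 / (1 + y) ^ N`. -/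
def F (N : ℕ) (y : ℝ) : ℝ := 1 - 1 / (1 + y) ^ N

namespace Network

variable {K : ℕ} (net : Network K)

/-- `Λ_k (y)`. -/
def Lam (k : Fin K) (y : ℝ) : ℝ :=
  2 * Real.pi * net.lam k / net.β k ^ 2 *
      (1 - Real.exp (-net.β k * y ^ (1 / net.αL k)) * (1 + net.β k * y ^ (1 / net.αL k)))
    + Real.pi * net.lam k * y ^ (2 / net.αN k)
    - 2 * Real.pi * net.lam k / net.β k ^ 2 *
      (1 - Real.exp (-net.β k * y ^ (1 / net.αN k)) * (1 + net.β k * y ^ (1 / net.αN k)))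

/-- The function `λ̄_k (p)` for users of tier `j`. -/
def lamBar (j k : Fin K) (p : ℝ) : ℝ :=
  2 * Real.pi * net.lam k / (net.αL k * net.ρ j ^ (2 / net.αL k)) * p ^ (2 / net.αL k - 1) *
      Real.exp (-net.β k * (p / net.ρ j) ^ (1 / net.αL k))
    + 2 * Real.pi * net.lam k / (net.αN k * net.ρ j ^ (2 / net.αN k)) * p ^ (2 / net.αN k - 1) *
      (1 - Real.exp (-net.β k * (p / net.ρ j) ^ (1 / net.αN k)))

/-- The density `f_{P_j}` of the transmit power of a user of tier `j`, on `0 < p ≤ Pu`. -/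
def powerPDF (j : Fin K) (p : ℝ) : ℝ :=
  (∑ k, net.lamBar j k p) / (1 - Real.exp (-∑ k, net.Lam k (net.Pu / net.ρ j))) *
    Real.exp (-∑ k, net.Lam k (p / net.ρ j))

/-- `q_v^j = η n θ_j a_v^j / (ρ_j G_j)`. -/
def q (n : ℕ) (j : Fin K) (v : Fin 4) : ℝ :=
  eta net.N * n * net.θ j * net.a j v / (net.ρ j * net.G j)

/-- The lower limit of integration `(η n θ_j a_v^j ρ_k / (ρ_j G_j)) ^ (-1/α)`. -/
def lower (n : ℕ) (j k : Fin K) (v : Fin 4) (α : ℝ) : ℝ :=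
  (eta net.N * n * net.θ j * net.a j v * net.ρ k / (net.ρ j * net.G j)) ^ (-(1 / α))

/-- `Q_n^k`, as an element of `[0, ∞]` (the integrand is nonnegative). -/
def Q (n : ℕ) (j k : Fin K) : ℝ≥0∞ :=
  ENNReal.ofReal (2 * Real.pi * net.lam k) *
    ∑ v : Fin 4, ENNReal.ofReal (net.b j v * net.q n j v ^ (2 / net.αL j)) *
      ∫⁻ y in Set.Ioi (net.lower n j k v (net.αL j)), ∫⁻ p in Set.Ioc 0 net.Pu,
        ENNReal.ofReal (F net.N (y ^ (-net.αL j) / net.N) *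
          Real.exp (-net.β j * (net.q n j v * p) ^ (1 / net.αL j) * y) *
          y * p ^ (2 / net.αL j) * net.powerPDF k p)

/-- `V_n^k`, as an element of `[0, ∞]` (the integrand is nonnegative). -/
def V (n : ℕ) (j k : Fin K) : ℝ≥0∞ :=
  ENNReal.ofReal (2 * Real.pi * net.lam k) *
    ∑ v : Fin 4, ENNReal.ofReal (net.b j v * net.q n j v ^ (2 / net.αN j)) *
      ∫⁻ y in Set.Ioi (net.lower n j k v (net.αN j)), ∫⁻ p in Set.Ioc 0 net.Pu,
        ENNReal.ofReal (F net.N (y ^ (-net.αN j) / net.N) *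
          (1 - Real.exp (-net.β j * (net.q n j v * p) ^ (1 / net.αN j) * y)) *
          y * p ^ (2 / net.αN j) * net.powerPDF k p)

/-- The closed form of the SINR outage probability of tier `j`. -/
def outageFormula (j : Fin K) : ℝ :=
  1 - ∑ n ∈ Finset.Icc 1 net.N, (-1 : ℝ) ^ (n + 1) * (net.N.choose n : ℝ) *
    expNeg (ENNReal.ofReal (eta net.N * n * net.θ j * net.σ ^ 2 / (net.ρ j * net.G j)) +
      ∑ k, (net.Q n j k + net.V n j k))

end Network

end MmWave

end

/-!
The transform `exp (-s I)` of the interference turns everything into Laplace functionals of Poisson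
processes, and these are known explicitly: for a Poisson process `X` with intensity `Λ` and
`f : E → [0, ∞]`,
`E exp (-∑ f (X i)) = exp (-∫ (1 - exp (-f)) dΛ)` (`IsPoissonProcess.lintegral_eneg_tsum`).
For simple `f` this is the independence of the Poisson counts on disjoint sets, and the general case
follows by monotone approximation; working with values in `[0, ∞]` and `exp (-∞) = 0` makes the case
of an infinite integral harmless. Independent marks can be averaged one point at a time, which
replaces `exp (-f (x))` by its mean over the mark (`lintegral_eneg_marked_poisson`).

This is used twice. With a functional taking the values `0` and `∞` it gives the void probability
`P (minLoss ≥ y) = exp (-∑ Λ_k (y))` of the marked base station processes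
(`BaseStations.IsModel.measure_le_minLoss`); since `Λ_k (p / ρ)` has derivative `λ̄_k (p)`, the
conditional law of the transmit power has density `powerPDF` (`BaseStations.IsModel.powerLaw_eq`).
With `s` times the received power it gives the Laplace transform of the interference. The mean over
the Gamma fading produces the function `F`, the mean over the blockage variable the LOS and NLOS
weights, and in polar coordinates the substitution `r = (q p) ^ (1 / α) y` turns the result into
`Q + V` (`Network.lintegral_contribution_eq`). Expanding `(1 - exp (-η x)) ^ N` by the binomial
theorem then yields the closed form (`Uplink.IsModel.approxOutage_eq`).

The exact outage probability is the mean of the Gamma distribution function at a multiple of noise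
plus interference, because the desired fading is independent of the rest
(`Uplink.IsModel.measure_outage`). The comparison is therefore Alzer's inequality
`(1 - exp (-η x)) ^ N ≤ P (g ≤ x)` for Gamma variables (`one_sub_exp_pow_le_cdf_gammaMeasure`). The
difference of both sides vanishes at `0` and `∞`, and its derivative changes sign only once, by the
convexity of `u ↦ (exp (κ u) - exp ((κ - 1) u)) / u`.
-/

namespace MmWave

open Filter Topology

/-! ### The exponential `exp (-x)` on `[0, ∞]` -/

/-- `exp (-x)` for `x ∈ [0, ∞]`, with values in `[0, ∞]`. Expectations of this function are Lebesgue
integrals, so that no integrability has to be discussed. -/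
noncomputable def eneg (x : ℝ≥0∞) : ℝ≥0∞ := EReal.exp (-(x : EReal))

lemma continuous_eneg : Continuous eneg :=
  ENNReal.continuous_exp.comp (continuous_neg.comp continuous_coe_ennreal_ereal)

@[fun_prop]
lemma measurable_eneg : Measurable eneg := continuous_eneg.measurable

lemma eneg_anti : Antitone eneg := fun _ _ h =>
  EReal.exp_monotone (EReal.neg_le_neg_iff.2 (EReal.coe_ennreal_le_coe_ennreal_iff.2 h))

@[simp] lemma eneg_zero : eneg 0 = 1 := by simp [eneg]

@[simp] lemma eneg_top : eneg ∞ = 0 := by simp [eneg]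

lemma eneg_le_one (x : ℝ≥0∞) : eneg x ≤ 1 := eneg_zero ▸ eneg_anti zero_le

lemma eneg_ne_top (x : ℝ≥0∞) : eneg x ≠ ∞ := ((eneg_le_one x).trans_lt ENNReal.one_lt_top).ne

lemma eneg_ofReal {x : ℝ} (hx : 0 ≤ x) :
    eneg (ENNReal.ofReal x) = ENNReal.ofReal (Real.exp (-x)) := by
  rw [eneg, EReal.coe_ennreal_ofReal, max_eq_left hx, ← EReal.coe_neg, EReal.exp_coe]

lemma toReal_eneg (x : ℝ≥0∞) : (eneg x).toReal = expNeg x := by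
  rcases eq_or_ne x ∞ with rfl | hx
  · simp [expNeg]
  · rw [← ENNReal.ofReal_toReal hx, eneg_ofReal ENNReal.toReal_nonneg,
      ENNReal.toReal_ofReal (Real.exp_nonneg _)]
    simp [expNeg]

lemma eneg_add (x y : ℝ≥0∞) : eneg (x + y) = eneg x * eneg y := by
  rcases eq_or_ne x ∞ with rfl | hx
  · simp
  rcases eq_or_ne y ∞ with rfl | hy
  · simp
  rw [← ENNReal.ofReal_toReal hx, ← ENNReal.ofReal_toReal hy,
    ← ENNReal.ofReal_add ENNReal.toReal_nonneg ENNReal.toReal_nonneg,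
    eneg_ofReal (by positivity), eneg_ofReal ENNReal.toReal_nonneg,
    eneg_ofReal ENNReal.toReal_nonneg, ← ENNReal.ofReal_mul (Real.exp_nonneg _), ← Real.exp_add]
  ring_nf

lemma eneg_sum {ι : Type*} (s : Finset ι) (f : ι → ℝ≥0∞) :
    eneg (∑ i ∈ s, f i) = ∏ i ∈ s, eneg (f i) := by
  classical
  induction s using Finset.induction_on with
  | empty => simp
  | insert a s ha ih => rw [Finset.sum_insert ha, Finset.prod_insert ha, eneg_add, ih]

lemma eneg_mul_natCast (x : ℝ≥0∞) (n : ℕ) : eneg (x * n) = eneg x ^ n := by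
  induction n with
  | zero => simp
  | succ n ih => rw [Nat.cast_succ, mul_add, mul_one, eneg_add, ih, pow_succ]

lemma tendsto_prod_eneg {ι : Type*} [Countable ι] (f : ι → ℝ≥0∞) :
    Tendsto (fun s : Finset ι => ∏ i ∈ s, eneg (f i)) atTop (𝓝 (eneg (∑' i, f i))) := by
  simp_rw [← eneg_sum]
  exact (continuous_eneg.tendsto _).comp ENNReal.summable.hasSum

/-- The inverse of `eneg` on `[0, 1]`. -/
noncomputable def nlog (y : ℝ≥0∞) : ℝ≥0∞ := (-(ENNReal.log y)).toENNReal

@[fun_prop]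
lemma measurable_nlog : Measurable nlog :=
  (ENNReal.measurable_log.neg).ereal_toENNReal

lemma eneg_nlog {y : ℝ≥0∞} (hy : y ≤ 1) : eneg (nlog y) = y := by
  rw [eneg, nlog, EReal.coe_toENNReal, neg_neg, ENNReal.exp_log]
  rw [EReal.neg_nonneg, ← ENNReal.log_one]
  exact ENNReal.log_monotone hy

/-! ### The Laplace functional of a Poisson process -/

section Poisson

variable {Ω E : Type*} [MeasurableSpace Ω] [MeasurableSpace E] {X : ℕ → Ω → E} {Λ : Measure E}
  {P : Measure Ω}

lemma IsPoissonProcess.measurable_count (h : IsPoissonProcess X Λ P) {A : Set E}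
    (hA : MeasurableSet A) : Measurable (count X A) :=
  Measurable.tsum fun i => (measurable_const.indicator hA).comp (h.measurable i)

/-- The generating function of the Poisson law. -/
lemma eneg_one_sub_mul_eq_tsum (z r : ℝ≥0) (hz : z ≤ 1) :
    ∑' n : ℕ, (z : ℝ≥0∞) ^ n * poissonMeasure r {n} = eneg ((1 - z) * r) := by
  have h1 : ∀ n : ℕ, (z : ℝ≥0∞) ^ n * poissonMeasure r {n} =
      ENNReal.ofReal (Real.exp (-r) * ((r * z : ℝ) ^ n / n !)) := fun n => by
    rw [poissonMeasure_singleton, ← ENNReal.ofReal_coe_nnreal, ← ENNReal.ofReal_pow (by positivity),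
      ← ENNReal.ofReal_mul (by positivity), mul_pow]
    congr 1; ring
  simp_rw [h1]
  have hs := (NormedSpace.expSeries_div_hasSum_exp ((r : ℝ) * z)).mul_left (Real.exp (-r))
  rw [← ENNReal.ofReal_tsum_of_nonneg (fun n => by positivity) hs.summable, hs.tsum_eq,
    ← Real.exp_eq_exp_ℝ, ← Real.exp_add]
  have hz' : (1 - (z : ℝ≥0∞)) * r = ENNReal.ofReal ((1 - z) * r) := by
    rw [ENNReal.ofReal_mul (by simpa using hz), ENNReal.ofReal_sub _ (by positivity)]
    simp
  rw [hz', eneg_ofReal (mul_nonneg (by simpa using hz) (by positivity))]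
  congr 2; ring

lemma IsPoissonProcess.lintegral_eneg_count [IsProbabilityMeasure P]
    (h : IsPoissonProcess X Λ P) {A : Set E} (hA : MeasurableSet A) (hΛ : Λ A ≠ ∞) (c : ℝ≥0∞) :
    ∫⁻ ω, eneg (c * count X A ω) ∂P = eneg ((1 - eneg c) * Λ A) := by
  have hm := h.measurable_count hA
  have hmn : ∀ n : ℕ, MeasurableSet {ω | count X A ω = n} := fun n => hm (measurableSet_singleton _)
  have hdisj : Pairwise (Function.onFun Disjoint fun n : ℕ => {ω | count X A ω = n}) := by
    intro m n hmn
    refine Set.disjoint_left.2 fun ω h1 h2 => hmn ?_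
    have : (m : ℝ≥0∞) = n := h1.symm.trans h2
    exact_mod_cast this
  have huniv : P (⋃ n : ℕ, {ω | count X A ω = n}) = 1 := by
    rw [measure_iUnion hdisj hmn]
    simp_rw [h.poisson A hA hΛ]
    rw [← measure_iUnion (fun m n hmn => by simpa using hmn) (fun n => measurableSet_singleton n),
      Set.iUnion_of_singleton, measure_univ]
  have hae : (⋃ n : ℕ, {ω | count X A ω = n}) =ᵐ[P] Set.univ :=
    (ae_eq_univ_iff_measure_eq (MeasurableSet.iUnion hmn).nullMeasurableSet).2 (by simp [huniv])
  rw [← setLIntegral_univ, ← setLIntegral_congr hae, lintegral_iUnion hmn hdisj]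
  have : ∀ n : ℕ, ∫⁻ ω in {ω | count X A ω = n}, eneg (c * count X A ω) ∂P =
      ((eneg c).toNNReal : ℝ≥0∞) ^ n * poissonMeasure (Λ A).toNNReal {n} := fun n => by
    rw [setLIntegral_congr_fun (g := fun _ => eneg c ^ n) (hmn n), setLIntegral_const,
      h.poisson A hA hΛ, ENNReal.coe_toNNReal (eneg_ne_top c)]
    intro ω (hω : _ = _)
    simp only [hω, eneg_mul_natCast]
  simp_rw [this]
  rw [eneg_one_sub_mul_eq_tsum _ _ (by
      rw [← ENNReal.coe_le_coe, ENNReal.coe_toNNReal (eneg_ne_top c)]; exact eneg_le_one c),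
    ENNReal.coe_toNNReal (eneg_ne_top c), ENNReal.coe_toNNReal hΛ]

/-- The Laplace functional for simple functions. The level set of the value `0` may have infinite
intensity; it does not contribute. -/
lemma IsPoissonProcess.lintegral_eneg_simpleFunc [IsProbabilityMeasure P]
    (h : IsPoissonProcess X Λ P) (f : SimpleFunc E ℝ≥0∞)
    (hf : ∀ y, y ≠ 0 → Λ (f ⁻¹' {y}) ≠ ∞) :
    ∫⁻ ω, eneg (∑' i, f (X i ω)) ∂P = eneg (∫⁻ x, (1 - eneg (f x)) ∂Λ) := by
  have hsum : ∀ ω, ∑' i, f (X i ω) = ∑ y : f.range, y * count X (f ⁻¹' {(y : ℝ≥0∞)}) ω :=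
      fun ω => by
    rw [Finset.sum_coe_sort f.range (fun y => y * count X (f ⁻¹' {y}) ω)]
    simp_rw [count, ← ENNReal.tsum_mul_left]
    rw [← Summable.tsum_finsetSum (fun _ _ => ENNReal.summable)]
    refine tsum_congr fun i => ?_
    rw [Finset.sum_eq_single (f (X i ω))]
    · simp
    · intro y _ hy
      simp [Set.indicator, hy.symm]
    · intro hn
      exact absurd (f.mem_range_self _) hn
  let e := Fintype.equivFin f.range
  have hind := h.indep _ (fun i => f ⁻¹' {((e.symm i : f.range) : ℝ≥0∞)})
    (fun i => f.measurableSet_preimage _) (fun i i' hii => by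
      refine Disjoint.preimage _ (Set.disjoint_singleton.2 fun heq => hii ?_)
      exact e.symm.injective (Subtype.ext heq))
  have hmeas : ∀ y : ℝ≥0∞, Measurable fun t => eneg (y * t) := fun y => by fun_prop
  have hind' := hind.comp (fun i t => eneg ((e.symm i : f.range) * t)) (fun i => hmeas _)
  have hR : ∫⁻ x, (1 - eneg (f x)) ∂Λ = ∑ y ∈ f.range, (1 - eneg y) * Λ (f ⁻¹' {y}) := by
    rw [← SimpleFunc.map_lintegral (fun y => 1 - eneg y) f, ← SimpleFunc.lintegral_eq_lintegral]
    rfl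
  have hprod : ∀ ω, eneg (∑' i, f (X i ω)) =
      ∏ i, eneg ((e.symm i : f.range) * count X (f ⁻¹' {((e.symm i : f.range) : ℝ≥0∞)}) ω) :=
    fun ω => by
      rw [hsum, eneg_sum]
      exact (e.symm.prod_comp fun y : f.range => eneg (y * count X (f ⁻¹' {(y : ℝ≥0∞)}) ω)).symm
  simp_rw [hprod]
  refine (lintegral_prod_eq_prod_lintegral_of_indepFun Finset.univ _ hind' fun i =>
    (hmeas _).comp (h.measurable_count (f.measurableSet_preimage _))).trans ?_
  rw [hR, eneg_sum, ← Finset.prod_coe_sort f.range, ← e.symm.prod_comp]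
  refine Finset.prod_congr rfl fun i _ => ?_
  rcases eq_or_ne ((e.symm i : f.range) : ℝ≥0∞) 0 with h0 | h0
  · simp [h0]
  · exact h.lintegral_eneg_count (f.measurableSet_preimage _) (hf _ h0) _

/-- The Laplace functional of a Poisson process. The integral on the right may be infinite, in which
case both sides vanish. -/
theorem IsPoissonProcess.lintegral_eneg_tsum [IsProbabilityMeasure P] [SigmaFinite Λ]
    (h : IsPoissonProcess X Λ P) {f : E → ℝ≥0∞} (hf : Measurable f) :
    ∫⁻ ω, eneg (∑' i, f (X i ω)) ∂P = eneg (∫⁻ x, (1 - eneg (f x)) ∂Λ) := by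
  let g : ℕ → SimpleFunc E ℝ≥0∞ := fun n => (SimpleFunc.eapprox f n).restrict (spanningSets Λ n)
  have hg : ∀ n x, g n x = (spanningSets Λ n).indicator (SimpleFunc.eapprox f n) x := fun n x => by
    simp [g, SimpleFunc.restrict_apply _ (measurableSet_spanningSets Λ n)]
  have hmono : ∀ x, Monotone fun n => g n x := by
    intro x m n hmn
    simp only [hg]
    refine (Set.indicator_le_indicator (SimpleFunc.monotone_eapprox f hmn x)).trans ?_
    exact Set.indicator_le_indicator_of_subset (monotone_spanningSets Λ hmn) (fun _ => zero_le) x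
  -- Cutting off outside the sets of finite intensity makes the level sets of `g n` admissible.
  have hlim : ∀ x, Tendsto (fun n => g n x) atTop (𝓝 (f x)) := by
    intro x
    have h1 : Tendsto (fun n => SimpleFunc.eapprox f n x) atTop (𝓝 (f x)) := by
      rw [← SimpleFunc.iSup_eapprox_apply hf x]
      exact tendsto_atTop_iSup fun m n hmn => SimpleFunc.monotone_eapprox f hmn x
    refine h1.congr' ?_
    filter_upwards [eventually_ge_atTop (spanningSetsIndex Λ x)] with n hn
    rw [hg, Set.indicator_of_mem]
    exact mem_spanningSets_of_index_le Λ x hn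
  have hfin : ∀ n y, y ≠ 0 → Λ (g n ⁻¹' {y}) ≠ ∞ := by
    intro n y hy
    refine ((measure_mono ?_).trans_lt (measure_spanningSets_lt_top Λ n)).ne
    intro x hx
    by_contra hxn
    rw [Set.mem_preimage, hg, Set.indicator_of_notMem hxn] at hx
    exact hy hx.symm
  have hL : Tendsto (fun n => ∫⁻ ω, eneg (∑' i, g n (X i ω)) ∂P) atTop
      (𝓝 (∫⁻ ω, eneg (∑' i, f (X i ω)) ∂P)) := by
    refine tendsto_lintegral_of_dominated_convergence (fun _ => 1) (fun n => ?_) (fun n => ?_)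
      (by simp) (ae_of_all _ fun ω => ?_)
    · exact measurable_eneg.comp (Measurable.tsum fun i => (g n).measurable.comp (h.measurable i))
    · exact ae_of_all _ fun ω => eneg_le_one _
    · refine (continuous_eneg.tendsto _).comp ?_
      simp_rw [← lintegral_count]
      exact lintegral_tendsto_of_tendsto_of_monotone (fun n => measurable_from_nat.aemeasurable)
        (ae_of_all _ fun i => hmono _) (ae_of_all _ fun i => hlim _)
  have hRR : Tendsto (fun n => eneg (∫⁻ x, (1 - eneg (g n x)) ∂Λ)) atTop
      (𝓝 (eneg (∫⁻ x, (1 - eneg (f x)) ∂Λ))) := by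
    refine (continuous_eneg.tendsto _).comp ?_
    refine lintegral_tendsto_of_tendsto_of_monotone (fun n => ?_) (ae_of_all _ fun x => ?_)
      (ae_of_all _ fun x => ?_)
    · exact (measurable_const.sub (measurable_eneg.comp (g n).measurable)).aemeasurable
    · intro m n hmn
      exact tsub_le_tsub_left (eneg_anti (hmono x hmn)) _
    · exact ENNReal.Tendsto.sub tendsto_const_nhds ((continuous_eneg.tendsto _).comp (hlim x))
        (Or.inl ENNReal.one_ne_top)
  refine tendsto_nhds_unique hL (hRR.congr fun n => ?_)
  exact (h.lintegral_eneg_simpleFunc (g n) (hfin n)).symm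

end Poisson

/-! ### Independently marked Poisson processes -/

section Marks

variable {Ω E F : Type*} [mΩ : MeasurableSpace Ω] [MeasurableSpace E] [MeasurableSpace F]
  {P : Measure Ω}

/-- Integrating out a variable that is independent of all others. -/
lemma lintegral_mul_comp_of_indep {Ω E F : Type*} {m₁ m₂ mΩ : MeasurableSpace Ω}
    [MeasurableSpace E] [MeasurableSpace F] {P : Measure Ω} [IsProbabilityMeasure P]
    (h₁ : m₁ ≤ mΩ) (h₂ : m₂ ≤ mΩ) (hind : Indep m₁ m₂ P) {Z : Ω → ℝ≥0∞} {Y : Ω → E} {M : Ω → F}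
    (hZ : Measurable[m₁] Z) (hY : Measurable[m₁] Y) (hM : Measurable[m₂] M)
    {Φ : E × F → ℝ≥0∞} (hΦ : Measurable Φ) :
    ∫⁻ ω, Z ω * Φ (Y ω, M ω) ∂P = ∫⁻ ω, Z ω * ∫⁻ u, Φ (Y ω, u) ∂(P.map M) ∂P := by
  have hZY : Measurable[m₁] fun ω => (Z ω, Y ω) := hZ.prodMk hY
  have hZY' : Measurable fun ω => (Z ω, Y ω) := hZY.mono h₁ le_rfl
  have hM' : Measurable M := hM.mono h₂ le_rfl
  have hI : IndepFun (fun ω => (Z ω, Y ω)) M P :=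
    indep_of_indep_of_le_left (indep_of_indep_of_le_right hind hM.comap_le) hZY.comap_le
  have := Measure.isProbabilityMeasure_map (μ := P) hM'.aemeasurable
  have hg : Measurable fun t : (ℝ≥0∞ × E) × F => t.1.1 * Φ (t.1.2, t.2) := by fun_prop
  calc ∫⁻ ω, Z ω * Φ (Y ω, M ω) ∂P
      = ∫⁻ t, t.1.1 * Φ (t.1.2, t.2) ∂(P.map fun ω => ((Z ω, Y ω), M ω)) :=
        (lintegral_map hg (hZY'.prodMk hM')).symm
    _ = ∫⁻ a, ∫⁻ u, a.1 * Φ (a.2, u) ∂(P.map M) ∂(P.map fun ω => (Z ω, Y ω)) := by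
        rw [hI.map_prod_eq_prod_map_map hZY'.aemeasurable hM'.aemeasurable,
          lintegral_prod _ hg.aemeasurable]
    _ = ∫⁻ ω, ∫⁻ u, Z ω * Φ (Y ω, u) ∂(P.map M) ∂P :=
        lintegral_map hg.lintegral_prod_right' hZY'
    _ = ∫⁻ ω, Z ω * ∫⁻ u, Φ (Y ω, u) ∂(P.map M) ∂P := by
        refine lintegral_congr fun ω => lintegral_const_mul _ ?_
        exact hΦ.comp measurable_prodMk_left

variable {S ι : Type*} {m : S → MeasurableSpace Ω}

/-- Averaging a finite product over independent marks `M q`, given the positions `Y q`: the marks are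
integrated out one at a time. -/
lemma lintegral_prod_marks [IsProbabilityMeasure P] (hm : ∀ s, m s ≤ mΩ) (hind : iIndep m P)
    {L : Set S} {T : ι → Set S} (hLT : ∀ q, Disjoint L (T q))
    (hT : Pairwise (Function.onFun Disjoint T)) {Y : ι → Ω → E} {M : ι → Ω → F}
    (hY : ∀ q, Measurable[⨆ s ∈ L, m s] (Y q)) (hM : ∀ q, Measurable[⨆ s ∈ T q, m s] (M q))
    {Φ : ι → E × F → ℝ≥0∞} (hΦ : ∀ q, Measurable (Φ q)) (s : Finset ι) {W : Ω → ℝ≥0∞}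
    (hW : Measurable[⨆ s ∈ L, m s] W) :
    ∫⁻ ω, W ω * ∏ q ∈ s, Φ q (Y q ω, M q ω) ∂P =
      ∫⁻ ω, W ω * ∏ q ∈ s, ∫⁻ u, Φ q (Y q ω, u) ∂(P.map (M q)) ∂P := by
  classical
  have hle : ∀ A : Set S, ⨆ s ∈ A, m s ≤ mΩ := fun A => iSup₂_le fun s _ => hm s
  have hmono : ∀ {A B : Set S}, A ⊆ B → ⨆ s ∈ A, m s ≤ ⨆ s ∈ B, m s :=
    fun h => biSup_mono h
  induction s using Finset.induction_on generalizing W with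
  | empty => simp
  | insert a s ha ih =>
    have := fun q => Measure.isProbabilityMeasure_map (μ := P)
      ((hM q).mono (hle _) le_rfl).aemeasurable
    let A : Set S := L ∪ ⋃ q ∈ s, T q
    have hdisj : Disjoint A (T a) := by
      refine Set.disjoint_union_left.2 ⟨hLT a, Set.disjoint_iUnion₂_left.2 fun q hq => hT ?_⟩
      rintro rfl
      exact ha hq
    have hLA : L ⊆ A := Set.subset_union_left
    have hTA : ∀ q ∈ s, T q ⊆ A := fun q hq =>
      (Set.subset_biUnion_of_mem (u := T) hq).trans Set.subset_union_right
    have hZ : Measurable[⨆ s ∈ A, m s] fun ω => W ω * ∏ q ∈ s, Φ q (Y q ω, M q ω) := by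
      refine Measurable.mul (hW.mono (hmono hLA) le_rfl) (Finset.measurable_fun_prod _ fun q hq => ?_)
      exact (hΦ q).comp (((hY q).mono (hmono hLA) le_rfl).prodMk
        ((hM q).mono (hmono (hTA q hq)) le_rfl))
    have hΦa : Measurable fun x => ∫⁻ u, Φ a (x, u) ∂(P.map (M a)) := (hΦ a).lintegral_prod_right'
    calc ∫⁻ ω, W ω * ∏ q ∈ insert a s, Φ q (Y q ω, M q ω) ∂P
        = ∫⁻ ω, (W ω * ∏ q ∈ s, Φ q (Y q ω, M q ω)) * Φ a (Y a ω, M a ω) ∂P := by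
          refine lintegral_congr fun ω => ?_
          rw [Finset.prod_insert ha]; ring
      _ = ∫⁻ ω, (W ω * ∏ q ∈ s, Φ q (Y q ω, M q ω)) *
            ∫⁻ u, Φ a (Y a ω, u) ∂(P.map (M a)) ∂P :=
          lintegral_mul_comp_of_indep (hle _) (hle _) (indep_iSup_of_disjoint hm hind hdisj) hZ
            ((hY a).mono (hmono hLA) le_rfl) (hM a) (hΦ a)
      _ = ∫⁻ ω, (W ω * ∫⁻ u, Φ a (Y a ω, u) ∂(P.map (M a))) *
            ∏ q ∈ s, Φ q (Y q ω, M q ω) ∂P := by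
          refine lintegral_congr fun ω => ?_
          ring
      _ = _ := by
          rw [ih (W := fun ω => W ω * ∫⁻ u, Φ a (Y a ω, u) ∂(P.map (M a)))
            (hW.mul (hΦa.comp (hY a)))]
          refine lintegral_congr fun ω => ?_
          rw [Finset.prod_insert ha]; ring

/-- Averaging over the independent marks of countably many points: in the Laplace functional, the cost
`c q (Y q, M q)` is replaced by the function of the position `Y q` whose exponential is the mean of
`exp (-c q (Y q, M q))` over the mark. -/
lemma lintegral_eneg_marks [Countable ι] [IsProbabilityMeasure P] (hm : ∀ s, m s ≤ mΩ)
    (hind : iIndep m P) {L : Set S} {T : ι → Set S} (hLT : ∀ q, Disjoint L (T q))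
    (hT : Pairwise (Function.onFun Disjoint T)) {Y : ι → Ω → E} {M : ι → Ω → F}
    (hY : ∀ q, Measurable[⨆ s ∈ L, m s] (Y q)) (hM : ∀ q, Measurable[⨆ s ∈ T q, m s] (M q))
    {c : ι → E × F → ℝ≥0∞} (hc : ∀ q, Measurable (c q)) :
    ∫⁻ ω, eneg (∑' q, c q (Y q ω, M q ω)) ∂P =
      ∫⁻ ω, eneg (∑' q, nlog (∫⁻ u, eneg (c q (Y q ω, u)) ∂(P.map (M q)))) ∂P := by
  have hle : ∀ A : Set S, ⨆ s ∈ A, m s ≤ mΩ := fun A => iSup₂_le fun s _ => hm s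
  have hM' := fun q => (hM q).mono (hle _) le_rfl
  have hY' := fun q => (hY q).mono (hle _) le_rfl
  have := fun q => Measure.isProbabilityMeasure_map (μ := P) (hM' q).aemeasurable
  have hav : ∀ q x, ∫⁻ u, eneg (c q (x, u)) ∂(P.map (M q)) ≤ 1 := fun q x =>
    (lintegral_mono fun u => eneg_le_one _).trans (by simp)
  have hlim : ∀ g : ι → Ω → ℝ≥0∞, (∀ q, Measurable (g q)) →
      Tendsto (fun s : Finset ι => ∫⁻ ω, ∏ q ∈ s, eneg (g q ω) ∂P) atTop
        (𝓝 (∫⁻ ω, eneg (∑' q, g q ω) ∂P)) := fun g hg => by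
    refine tendsto_lintegral_filter_of_dominated_convergence (fun _ => 1)
      (Eventually.of_forall fun s => Finset.measurable_fun_prod _ fun q _ => measurable_eneg.comp (hg q))
      (Eventually.of_forall fun s => ae_of_all _ fun ω => Finset.prod_le_one' fun q _ => eneg_le_one _)
      (by simp) (ae_of_all _ fun ω => tendsto_prod_eneg _)
  have hf : ∀ q, Measurable fun x => ∫⁻ u, eneg (c q (x, u)) ∂(P.map (M q)) := fun q =>
    (measurable_eneg.comp (hc q)).lintegral_prod_right'
  refine tendsto_nhds_unique (hlim _ fun q => (hc q).comp ((hY' q).prodMk (hM' q))) ?_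
  refine (hlim (fun q ω => nlog (∫⁻ u, eneg (c q (Y q ω, u)) ∂(P.map (M q)))) fun q =>
    measurable_nlog.comp ((hf q).comp (hY' q))).congr fun s => ?_
  have h := lintegral_prod_marks hm hind hLT hT hY hM (fun q => measurable_eneg.comp (hc q)) s
    (W := fun _ => 1) measurable_const
  simp only [one_mul, Function.comp_apply] at h
  simp_rw [h, eneg_nlog (hav _ _)]

/-- The Laplace functional of finitely many independent Poisson processes with independent marks. All
randomness comes from the independent σ-algebras `m s`: the positions of the `k`-th process from
`m (l k)`, and the mark of its `i`-th point from the `m s` with `s ∈ T k i`. -/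
theorem lintegral_eneg_marked_poisson {κ : Type*} [Fintype κ] [IsProbabilityMeasure P]
    (hm : ∀ s, m s ≤ mΩ) (hind : iIndep m P) {X : κ → ℕ → Ω → E} {Λ : κ → Measure E}
    [∀ k, SigmaFinite (Λ k)] (hX : ∀ k, IsPoissonProcess (X k) (Λ k) P) {M : κ → ℕ → Ω → F}
    {ν : κ → Measure F} (hν : ∀ k i, P.map (M k i) = ν k) {l : κ → S} (hl : Function.Injective l)
    (hXl : ∀ k i, Measurable[m (l k)] (X k i)) {T : κ → ℕ → Set S} (hlT : ∀ k' k i, l k' ∉ T k i)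
    (hT : Pairwise (Function.onFun Disjoint fun q : κ × ℕ => T q.1 q.2))
    (hMT : ∀ k i, Measurable[⨆ s ∈ T k i, m s] (M k i)) {c : κ → E × F → ℝ≥0∞}
    (hc : ∀ k, Measurable (c k)) :
    ∫⁻ ω, eneg (∑ k, ∑' i, c k (X k i ω, M k i ω)) ∂P =
      eneg (∑ k, ∫⁻ x, ∫⁻ u, (1 - eneg (c k (x, u))) ∂(ν k) ∂(Λ k)) := by
  classical
  have hsum : ∀ g : κ × ℕ → ℝ≥0∞, ∑' q, g q = ∑ k, ∑' i, g (k, i) := fun g => by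
    rw [ENNReal.tsum_prod', tsum_fintype]
  have hM' : ∀ k i, Measurable (M k i) := fun k i =>
    (hMT k i).mono (iSup₂_le fun s _ => hm s) le_rfl
  have hνp : ∀ k, IsProbabilityMeasure (ν k) := fun k => by
    rw [← hν k 0]; exact Measure.isProbabilityMeasure_map (hM' k 0).aemeasurable
  have hav : ∀ k x, ∫⁻ u, eneg (c k (x, u)) ∂(ν k) ≤ 1 := fun k x =>
    (lintegral_mono fun u => eneg_le_one _).trans (by simp)
  have hmarks := lintegral_eneg_marks (P := P) hm hind (L := Set.range l)
    (T := fun q : κ × ℕ => T q.1 q.2)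
    (fun q => Set.disjoint_left.2 (by rintro _ ⟨k', rfl⟩; exact hlT k' q.1 q.2)) hT
    (Y := fun q => X q.1 q.2) (M := fun q => M q.1 q.2)
    (fun q => (hXl q.1 q.2).mono (le_iSup₂_of_le (l q.1) ⟨q.1, rfl⟩ le_rfl) le_rfl)
    (fun q => hMT q.1 q.2) (c := fun q => c q.1) (fun q => hc q.1)
  simp only [hsum, hν] at hmarks
  rw [hmarks]
  simp_rw [eneg_sum]
  have hf : ∀ k, Measurable fun x => nlog (∫⁻ u, eneg (c k (x, u)) ∂(ν k)) := fun k =>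
    measurable_nlog.comp (measurable_eneg.comp (hc k)).lintegral_prod_right'
  have hZ : ∀ k, Measurable[m (l k)] fun ω =>
      eneg (∑' i, nlog (∫⁻ u, eneg (c k (X k i ω, u)) ∂(ν k))) := fun k =>
    (measurable_eneg.comp (Measurable.tsum fun i => (hf k).comp (measurable_pi_apply i)) :
      Measurable fun x : ℕ → E => eneg (∑' i, nlog (∫⁻ u, eneg (c k (x i, u)) ∂(ν k)))).comp
      (@measurable_pi_lambda Ω ℕ (fun _ => E) (m (l k)) _ _ fun i => hXl k i)
  have hindl : iIndepFun (fun k ω => eneg (∑' i, nlog (∫⁻ u, eneg (c k (X k i ω, u)) ∂(ν k)))) P := by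
    rw [iIndepFun_iff_iIndep]
    exact iIndep_of_iIndep_of_le (hind.precomp hl) fun k => (hZ k).comap_le
  rw [lintegral_prod_eq_prod_lintegral_of_indepFun _ _ hindl fun k => (hZ k).mono (hm _) le_rfl]
  refine Finset.prod_congr rfl fun k _ => ?_
  rw [(hX k).lintegral_eneg_tsum (hf k)]
  congr 1
  refine lintegral_congr fun x => ?_
  rw [eneg_nlog (hav k x), lintegral_sub, lintegral_const, measure_univ, one_mul]
  · exact (measurable_eneg.comp (hc k)).comp measurable_prodMk_left
  · exact ((hav k x).trans_lt ENNReal.one_lt_top).ne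
  · exact ae_of_all _ fun u => eneg_le_one _

end Marks

/-! ### Alzer's inequality for the Gamma distribution function -/

lemma integral_exp_mul_right (a b : ℝ) {u : ℝ} (hu : u ≠ 0) :
    ∫ t in a..b, Real.exp (t * u) = (Real.exp (b * u) - Real.exp (a * u)) / u := by
  rw [intervalIntegral.integral_comp_mul_right (fun t => Real.exp t) hu, integral_exp, smul_eq_mul]
  field_simp

/-- The quotient `(exp (κ u) - exp ((κ - 1) u)) / u` is the integral of `exp (t u)` over
`t ∈ [κ - 1, κ]`, hence convex in `u`; as it tends to `1` at `0`, it stays above `1` once it is. -/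
lemma le_exp_sub_exp_of_le {κ u w : ℝ} (hu : 0 < u) (huw : u ≤ w)
    (h : u ≤ Real.exp (κ * u) - Real.exp ((κ - 1) * u)) :
    w ≤ Real.exp (κ * w) - Real.exp ((κ - 1) * w) := by
  have hw : 0 < w := hu.trans_le huw
  have hl : u / w ≤ 1 := (div_le_one hw).2 huw
  have hpt : ∀ t ∈ Set.Icc (κ - 1) κ,
      Real.exp (t * u) ≤ (1 - u / w) + u / w * Real.exp (t * w) := fun t _ => by
    have := convexOn_exp.2 (Set.mem_univ (0 : ℝ)) (Set.mem_univ (t * w)) (sub_nonneg.2 hl)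
      (div_pos hu hw).le (by ring)
    simp only [smul_eq_mul, mul_zero, zero_add, Real.exp_zero, mul_one] at this
    rwa [show u / w * (t * w) = t * u by field_simp] at this
  have hint := intervalIntegral.integral_mono_on (μ := volume) (a := κ - 1) (b := κ) (by linarith)
    (Continuous.intervalIntegrable (by fun_prop) _ _)
    (Continuous.intervalIntegrable (by fun_prop) _ _) hpt
  rw [intervalIntegral.integral_add (Continuous.intervalIntegrable (by fun_prop) _ _)
    (Continuous.intervalIntegrable (by fun_prop) _ _), intervalIntegral.integral_const_mul,
    integral_exp_mul_right _ _ hu.ne', integral_exp_mul_right _ _ hw.ne',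
    intervalIntegral.integral_const] at hint
  have h1 : 1 ≤ (Real.exp (κ * u) - Real.exp ((κ - 1) * u)) / u := (one_le_div hu).2 h
  have h2 : 0 ≤ u / w * ((Real.exp (κ * w) - Real.exp ((κ - 1) * w)) / w - 1) := by
    simp only [sub_sub_cancel, one_smul] at hint
    linarith
  exact (one_le_div hw).1 (by linarith [(mul_nonneg_iff_of_pos_left (div_pos hu hw)).1 h2])

lemma eta_pos {N : ℕ} (hN : 0 < N) : 0 < eta N := by
  have : (0 : ℝ) < N := by exact_mod_cast hN
  have : (0 : ℝ) < N ! := by exact_mod_cast N.factorial_pos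
  unfold eta; positivity

lemma eta_pow {N : ℕ} (hN : 0 < N) : eta N ^ N = (N : ℝ) ^ N / N ! := by
  have hf : (0 : ℝ) < N ! := by exact_mod_cast N.factorial_pos
  rw [eta, mul_pow, ← Real.rpow_natCast ((N ! : ℝ) ^ _), ← Real.rpow_mul hf.le,
    show -(1 / (N : ℝ)) * N = -1 by have : (N : ℝ) ≠ 0 := by exact_mod_cast hN.ne'
                                    field_simp,
    Real.rpow_neg_one, div_eq_mul_inv]

lemma cdf_gammaMeasure_eq_intervalIntegral (n : ℕ) {x : ℝ} (hx : 0 ≤ x) :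
    cdf (gammaMeasure (n + 1 : ℕ) (n + 1 : ℕ)) x =
      ∫ t in (0 : ℝ)..x, ((n + 1 : ℕ) : ℝ) ^ (n + 1) / n ! * t ^ n * Real.exp (-((n + 1 : ℕ) * t)) := by
  rw [cdf_gammaMeasure_eq_integral (by positivity) (by positivity),
    intervalIntegral.integral_of_le hx, ← integral_Icc_eq_integral_Ioc]
  have hsub : Set.Icc 0 x ⊆ Set.Iic x := fun t ht => ht.2
  refine (setIntegral_eq_of_subset_of_forall_sdiff_eq_zero measurableSet_Iic hsub
    fun t ht => ?_).trans (setIntegral_congr_fun measurableSet_Icc fun t ht => ?_)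
  · have : ¬ 0 ≤ t := fun h0 => ht.2 ⟨h0, ht.1⟩
    simp [gammaPDFReal, this]
  · simp only [gammaPDFReal, if_pos ht.1, Real.rpow_natCast]
    congr 2
    · rw [Nat.cast_succ, Real.Gamma_nat_eq_factorial]
    · rw [Nat.cast_succ, add_sub_cancel_right, Real.rpow_natCast]

lemma hasDerivAt_cdf_gammaMeasure (n : ℕ) {x : ℝ} (hx : 0 < x) :
    HasDerivAt (cdf (gammaMeasure (n + 1 : ℕ) (n + 1 : ℕ)))
      (((n + 1 : ℕ) : ℝ) ^ (n + 1) / n ! * x ^ n * Real.exp (-((n + 1 : ℕ) * x))) x := by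
  have hc : Continuous fun t : ℝ =>
      ((n + 1 : ℕ) : ℝ) ^ (n + 1) / n ! * t ^ n * Real.exp (-((n + 1 : ℕ) * t)) := by fun_prop
  refine (hc.integral_hasStrictDerivAt 0 x).hasDerivAt.congr_of_eventuallyEq ?_
  filter_upwards [lt_mem_nhds hx] with y hy
  exact cdf_gammaMeasure_eq_intervalIntegral n hy.le

/-- Alzer's inequality. The difference of the two sides vanishes at `0` and at infinity, and its
derivative changes sign at most once, from plus to minus. -/
theorem one_sub_exp_pow_le_cdf_gammaMeasure {N : ℕ} (hN : 0 < N) {x : ℝ} (hx : 0 ≤ x) :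
    (1 - Real.exp (-(eta N * x))) ^ N ≤ cdf (gammaMeasure N N) x := by
  obtain ⟨n, rfl⟩ : ∃ n, N = n + 1 := ⟨N - 1, by omega⟩
  rcases Nat.eq_zero_or_pos n with rfl | hn
  · have h1 : cdf (gammaMeasure (0 + 1 : ℕ) (0 + 1 : ℕ)) = cdf (expMeasure 1) := by
      simp [expMeasure]
    rw [h1, cdf_expMeasure_eq one_pos, if_pos hx]
    simp [eta]
  set η := eta (n + 1) with hη
  have hη0 : 0 < η := eta_pos hN
  have hn' : (0 : ℝ) < n := by exact_mod_cast hn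
  -- With `u = η x`, this makes `exp (-N x) = exp (-u) * exp (-κ u) ^ n`.
  set κ : ℝ := ((n + 1 : ℕ) - η) / (η * n) with hκ
  set D : ℝ → ℝ := fun x =>
    cdf (gammaMeasure (n + 1 : ℕ) (n + 1 : ℕ)) x - (1 - Real.exp (-(η * x))) ^ (n + 1) with hD
  set D' : ℝ → ℝ := fun x => (n + 1) * η * Real.exp (-(η * x)) *
    ((η * x * Real.exp (-(κ * (η * x)))) ^ n - (1 - Real.exp (-(η * x))) ^ n) with hD'
  have hpow : ((n + 1 : ℕ) : ℝ) ^ (n + 1) / n ! = (n + 1) * η ^ (n + 1) := by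
    rw [hη, eta_pow hN, Nat.factorial_succ]
    have : (n ! : ℝ) ≠ 0 := by exact_mod_cast n.factorial_ne_zero
    push_cast
    field_simp
  have hderiv : ∀ x, 0 < x → HasDerivAt D (D' x) x := fun x hx => by
    have h2 : HasDerivAt (fun x => (1 - Real.exp (-(η * x))) ^ (n + 1)) _ x :=
      ((((hasDerivAt_id x).const_mul η).neg.exp).const_sub 1).pow (n + 1)
    refine ((hasDerivAt_cdf_gammaMeasure n hx).sub h2).congr_deriv ?_
    have hexp : Real.exp (-((n + 1 : ℕ) * x)) =
        Real.exp (-(η * x)) * Real.exp (-(κ * (η * x))) ^ n := by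
      rw [← Real.exp_nat_mul, ← Real.exp_add, hκ]
      congr 1
      field_simp
      ring
    simp only [hD', hpow, hexp, id, add_tsub_cancel_right, Pi.neg_apply]
    push_cast
    ring
  have hcont : ContinuousOn D (Set.Ici 0) := by
    refine ContinuousOn.sub (ContinuousOn.congr (f := fun x => ∫ t in (0 : ℝ)..x,
      ((n + 1 : ℕ) : ℝ) ^ (n + 1) / n ! * t ^ n * Real.exp (-((n + 1 : ℕ) * t)))
      (Continuous.continuousOn ?_) fun x hx => cdf_gammaMeasure_eq_intervalIntegral n hx)
      (by fun_prop)
    exact intervalIntegral.continuous_primitive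
      (fun a b => Continuous.intervalIntegrable (by fun_prop) _ _) 0
  have hD0 : D 0 = 0 := by
    simp only [hD, cdf_gammaMeasure_eq_intervalIntegral n le_rfl]
    simp
  have hlim : Tendsto D atTop (𝓝 0) := by
    have h1 : Tendsto (fun x => (1 - Real.exp (-(η * x))) ^ (n + 1)) atTop (𝓝 1) := by
      have := (((Real.tendsto_exp_neg_atTop_nhds_zero.comp
        (tendsto_id.const_mul_atTop hη0)).const_sub 1).pow (n + 1))
      simpa using this
    simpa [hD] using (tendsto_cdf_atTop (gammaMeasure (n + 1 : ℕ) (n + 1 : ℕ))).sub h1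
  -- A negative value of `D` at `x` forces `D' < 0` somewhere before `x`, hence `D' ≤ 0` after `x`, so
  -- that `D` cannot return to its limit `0`.
  by_contra hneg
  have hDx : D x < 0 := by simp only [hD]; linarith [not_le.1 hneg]
  have hx0 : 0 < x := hx.lt_of_ne (by rintro rfl; exact hDx.ne hD0)
  obtain ⟨y, hy, hyD⟩ := exists_hasDerivAt_eq_slope D D' hx0 (hcont.mono Set.Icc_subset_Ici_self)
    fun z hz => hderiv z hz.1
  have hD'y : D' y < 0 := by
    rw [hyD, hD0, sub_zero, sub_zero]; exact div_neg_of_neg_of_pos hDx hx0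
  -- The sign of `D' z` is that of `u - (exp (κ u) - exp ((κ - 1) u))` at `u = η z`.
  have hsplit : ∀ u, Real.exp (κ * u) - Real.exp ((κ - 1) * u) =
      Real.exp (κ * u) * (1 - Real.exp (-u)) := fun u => by
    rw [mul_sub, mul_one, ← Real.exp_add]; ring_nf
  have hyu : η * y ≤ Real.exp (κ * (η * y)) - Real.exp ((κ - 1) * (η * y)) := by
    by_contra hlt
    rw [hsplit] at hlt
    refine hD'y.not_ge (mul_nonneg (by positivity) (sub_nonneg.2 (pow_le_pow_left₀ ?_ ?_ n)))
    · have := hη0.le; have := hy.1.le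
      rw [sub_nonneg, Real.exp_le_one_iff, Left.neg_nonpos_iff]; positivity
    · rw [Real.exp_neg (κ * (η * y)), ← div_eq_mul_inv, le_div_iff₀ (Real.exp_pos _), mul_comm]
      exact (not_le.1 hlt).le
  have hD'z : ∀ z, x < z → D' z ≤ 0 := fun z hz => by
    have hz0 := hx0.trans hz
    have hzu := le_exp_sub_exp_of_le (mul_pos hη0 hy.1)
      (mul_le_mul_of_nonneg_left (hy.2.trans hz).le hη0.le) hyu
    rw [hsplit] at hzu
    refine mul_nonpos_of_nonneg_of_nonpos (by positivity)
      (sub_nonpos.2 (pow_le_pow_left₀ (by positivity) ?_ n))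
    rwa [Real.exp_neg (κ * (η * z)), ← div_eq_mul_inv, div_le_iff₀ (Real.exp_pos _),
      mul_comm _ (Real.exp _)]
  have hanti : AntitoneOn D (Set.Ici x) := by
    refine antitoneOn_of_hasDerivWithinAt_nonpos (f' := D') (convex_Ici x)
      (hcont.mono (Set.Ici_subset_Ici.2 hx)) (fun z hz => ?_) fun z hz => ?_
    · rw [interior_Ici] at hz
      exact (hderiv z (hx0.trans hz)).hasDerivWithinAt
    · rw [interior_Ici] at hz
      exact hD'z z hz
  have : (0 : ℝ) ≤ D x := le_of_tendsto hlim <| by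
    filter_upwards [eventually_ge_atTop x] with z hz using hanti Set.self_mem_Ici hz hz
  exact hDx.not_ge this

lemma gammaMeasure_ofReal_le {N : ℕ} (hN : 0 < N) {z : ℝ≥0∞} (hz : z ≠ ∞) :
    gammaMeasure N N {g | ENNReal.ofReal g ≤ z} =
      ENNReal.ofReal (cdf (gammaMeasure N N) z.toReal) := by
  have hN' : (0 : ℝ) < N := by exact_mod_cast hN
  have := isProbabilityMeasure_gammaMeasure hN' hN'
  rw [ofReal_cdf]
  congr 1
  ext g
  simp [ENNReal.ofReal_le_iff_le_toReal hz]

lemma approxFadingCDF_nonneg (N : ℕ) (z : ℝ≥0∞) : 0 ≤ approxFadingCDF N z := by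
  refine pow_nonneg (sub_nonneg.2 ?_) N
  rw [← toReal_eneg]
  exact ENNReal.toReal_le_of_le_ofReal zero_le_one (by simpa using eneg_le_one _)

lemma approxFadingCDF_of_ne_top {N : ℕ} (hN : 0 < N) {z : ℝ≥0∞} (hz : z ≠ ∞) :
    approxFadingCDF N z = (1 - Real.exp (-(eta N * z.toReal))) ^ N := by
  rw [approxFadingCDF, expNeg, if_neg (ENNReal.mul_ne_top ENNReal.ofReal_ne_top hz),
    ENNReal.toReal_mul, ENNReal.toReal_ofReal (eta_pos hN).le]

lemma approxFadingCDF_top {N : ℕ} (hN : 0 < N) : approxFadingCDF N ∞ = 1 := by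
  rw [approxFadingCDF, ENNReal.mul_top (by simpa using eta_pos hN)]
  simp [expNeg]

lemma approxFadingCDF_le {N : ℕ} (hN : 0 < N) (z : ℝ≥0∞) :
    ENNReal.ofReal (approxFadingCDF N z) ≤ gammaMeasure N N {g | ENNReal.ofReal g ≤ z} := by
  rcases eq_or_ne z ∞ with rfl | hz
  · have hN' : (0 : ℝ) < N := by exact_mod_cast hN
    have := isProbabilityMeasure_gammaMeasure hN' hN'
    simp [approxFadingCDF_top hN]
  · rw [gammaMeasure_ofReal_le hN hz, approxFadingCDF_of_ne_top hN hz]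
    exact ENNReal.ofReal_le_ofReal
      (one_sub_exp_pow_le_cdf_gammaMeasure hN ENNReal.toReal_nonneg)

lemma approxFadingCDF_one_eq (z : ℝ≥0∞) :
    ENNReal.ofReal (approxFadingCDF 1 z) =
      gammaMeasure (1 : ℕ) (1 : ℕ) {g | ENNReal.ofReal g ≤ z} := by
  rcases eq_or_ne z ∞ with rfl | hz
  · have := isProbabilityMeasure_gammaMeasure (one_pos (α := ℝ)) one_pos
    simp [approxFadingCDF_top one_pos]
  · rw [gammaMeasure_ofReal_le one_pos hz, approxFadingCDF_of_ne_top one_pos hz]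
    have h1 : cdf (gammaMeasure (1 : ℕ) (1 : ℕ)) = cdf (expMeasure 1) := by simp [expMeasure]
    rw [h1, cdf_expMeasure_eq one_pos, if_pos ENNReal.toReal_nonneg]
    simp [eta]

/-! ### The Laplace transform of the Gamma law -/

lemma lintegral_eneg_gammaMeasure {N : ℕ} (hN : 0 < N) {t : ℝ} (ht : 0 ≤ t) :
    ∫⁻ g, eneg (ENNReal.ofReal (t * g)) ∂(gammaMeasure N N) =
      ENNReal.ofReal (1 / (1 + t / N) ^ N) := by
  have hN' : (0 : ℝ) < N := by exact_mod_cast hN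
  have hm : Measurable (gammaPDF N N) := (measurable_gammaPDFReal _ _).ennreal_ofReal
  have hm' : Measurable (gammaPDF N (N + t)) := (measurable_gammaPDFReal _ _).ennreal_ofReal
  rw [gammaMeasure, lintegral_withDensity_eq_lintegral_mul _ hm (by fun_prop)]
  have : ∀ g : ℝ, (gammaPDF N N * fun g => eneg (ENNReal.ofReal (t * g))) g =
      ENNReal.ofReal (1 / (1 + t / N) ^ N) * gammaPDF N (N + t) g := fun g => by
    rcases lt_or_ge g 0 with hg | hg
    · simp [gammaPDF_of_neg hg]
    · rw [Pi.mul_apply, eneg_ofReal (by positivity), gammaPDF_of_nonneg hg, gammaPDF_of_nonneg hg,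
        ← ENNReal.ofReal_mul (by positivity), ← ENNReal.ofReal_mul (by positivity)]
      congr 1
      rw [mul_assoc, ← Real.exp_add, Real.rpow_natCast, Real.rpow_natCast,
        show 1 + t / (N : ℝ) = (N + t) / N by field_simp, div_pow]
      have : (0 : ℝ) < (N + t) ^ N := by positivity
      field_simp
      ring_nf
  simp_rw [this]
  rw [lintegral_const_mul _ hm', lintegral_gammaPDF_eq_one hN' (by positivity), mul_one]

lemma F_nonneg {N : ℕ} {y : ℝ} (hy : 0 ≤ y) : 0 ≤ F N y := by
  rw [F, sub_nonneg, div_le_one (by positivity)]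
  exact one_le_pow₀ (by linarith)

lemma lintegral_one_sub_eneg_gammaMeasure {N : ℕ} (hN : 0 < N) {t : ℝ} (ht : 0 ≤ t) :
    ∫⁻ g, (1 - eneg (ENNReal.ofReal (t * g))) ∂(gammaMeasure N N) = ENNReal.ofReal (F N (t / N)) := by
  have hN' : (0 : ℝ) < N := by exact_mod_cast hN
  have := isProbabilityMeasure_gammaMeasure hN' hN'
  rw [lintegral_sub (by fun_prop) (by rw [lintegral_eneg_gammaMeasure hN ht]; simp)
    (ae_of_all _ fun _ => eneg_le_one _), lintegral_eneg_gammaMeasure hN ht, F,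
    ENNReal.ofReal_sub _ (by positivity)]
  simp

/-! ### Integrals over the plane and over the blockage variable -/

/-- Polar coordinates for radial functions on the plane. -/
lemma lintegral_norm_plane {f : ℝ → ℝ≥0∞} (hf : Measurable f) :
    ∫⁻ x : Plane, f ‖x‖ = ENNReal.ofReal (2 * Real.pi) *
      ∫⁻ r in Set.Ioi (0 : ℝ), ENNReal.ofReal r * f r := by
  have hdim : Module.finrank ℝ Plane = 2 := by simp
  have hf' : Measurable fun r : Set.Ioi (0 : ℝ) => f r := hf.comp measurable_subtype_coe
  calc ∫⁻ x : Plane, f ‖x‖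
      = ∫⁻ x : ({0}ᶜ : Set Plane), f ‖x.1‖ ∂((volume : Measure Plane).comap Subtype.val) := by
        rw [lintegral_subtype_comap (measurableSet_singleton _).compl fun x : Plane => f ‖x‖,
          restrict_compl_singleton]
    _ = ∫⁻ x, f x.2 ∂(volume : Measure Plane).toSphere.prod (.volumeIoiPow 1) := by
        have := (volume : Measure Plane).measurePreserving_homeomorphUnitSphereProd
        have := this.lintegral_comp_emb (Homeomorph.measurableEmbedding _) (fun x => f x.2)
        rw [hdim] at this
        simpa using this
    _ = ENNReal.ofReal (2 * Real.pi) * ∫⁻ r : Set.Ioi (0 : ℝ), f r ∂.volumeIoiPow 1 := by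
        rw [lintegral_prod (fun x : Metric.sphere (0 : Plane) 1 × Set.Ioi (0 : ℝ) => f x.2)
          (hf'.comp measurable_snd).aemeasurable]
        simp only [lintegral_const]
        rw [Measure.toSphere_apply_univ, hdim, mul_comm, EuclideanSpace.volume_ball_fin_two,
          ENNReal.ofReal_mul (by norm_num)]
        simp
    _ = _ := by
        rw [Measure.volumeIoiPow, lintegral_withDensity_eq_lintegral_mul _ (by fun_prop) hf',
          ← lintegral_subtype_comap measurableSet_Ioi]
        simp

lemma measurableSet_isLOS (β : ℝ) : MeasurableSet {t : Plane × ℝ | IsLOS β ‖t.1‖ t.2} :=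
  measurableSet_le measurable_snd (by fun_prop)

open Classical in
/-- Averaging over the blockage variable of a link of length `r`. -/
lemma lintegral_uniformLaw_isLOS {β r : ℝ} (hβ : 0 < β) (hr : 0 ≤ r) (A B : ℝ≥0∞) :
    ∫⁻ u, (if IsLOS β r u then A else B) ∂uniformLaw =
      ENNReal.ofReal (Real.exp (-β * r)) * A + ENNReal.ofReal (1 - Real.exp (-β * r)) * B := by
  have he : Real.exp (-β * r) ≤ 1 := Real.exp_le_one_iff.2 (by nlinarith)
  have h0 := Real.exp_pos (-β * r)
  have h1 : ∀ u, (if IsLOS β r u then A else B) =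
      (Set.Iic (Real.exp (-β * r))).indicator (fun _ => A) u +
        (Set.Ioi (Real.exp (-β * r))).indicator (fun _ => B) u := fun u => by
    rcases le_or_gt u (Real.exp (-β * r)) with hu | hu
    · simp only [IsLOS, Set.indicator, Set.mem_Iic, Set.mem_Ioi, hu, hu.not_gt, if_true, if_false,
        add_zero]
    · simp only [IsLOS, Set.indicator, Set.mem_Iic, Set.mem_Ioi, hu, hu.not_ge, if_true, if_false,
        zero_add]
  simp_rw [h1]
  rw [lintegral_add_left (measurable_const.indicator measurableSet_Iic),
    lintegral_indicator_const measurableSet_Iic, lintegral_indicator_const measurableSet_Ioi,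
    uniformLaw, Measure.restrict_apply measurableSet_Iic, Measure.restrict_apply measurableSet_Ioi,
    mul_comm A, mul_comm B]
  congr 2
  · rw [show Set.Iic (Real.exp (-β * r)) ∩ Set.Icc 0 1 = Set.Icc 0 (Real.exp (-β * r)) by
      ext u; simp only [Set.mem_inter_iff, Set.mem_Iic, Set.mem_Icc]; grind]
    simp
  · rw [show Set.Ioi (Real.exp (-β * r)) ∩ Set.Icc 0 1 = Set.Ioc (Real.exp (-β * r)) 1 by
      ext u; simp only [Set.mem_inter_iff, Set.mem_Ioi, Set.mem_Icc, Set.mem_Ioc]; grind]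
    simp

/-- The fundamental theorem of calculus for Lebesgue integrals of nonnegative derivatives. -/
lemma setLIntegral_ofReal_deriv {g g' : ℝ → ℝ} {a b : ℝ} (hab : a ≤ b)
    (hcont : ContinuousOn g (Set.Icc a b)) (hderiv : ∀ x ∈ Set.Ioo a b, HasDerivAt g (g' x) x)
    (hpos : ∀ x ∈ Set.Ioo a b, 0 ≤ g' x) :
    ∫⁻ x in Set.Ioc a b, ENNReal.ofReal (g' x) = ENNReal.ofReal (g b - g a) := by
  have hint := intervalIntegral.integrableOn_deriv_of_nonneg hcont hderiv hpos
  rw [← intervalIntegral.integral_eq_sub_of_hasDerivAt_of_le hab hcont hderiv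
    ((intervalIntegrable_iff_integrableOn_Ioc_of_le hab).2 hint),
    intervalIntegral.integral_of_le hab, ofReal_integral_eq_lintegral_ofReal hint]
  rw [← restrict_Ioo_eq_restrict_Ioc]
  exact (ae_restrict_iff' measurableSet_Ioo).2 (ae_of_all _ hpos)

lemma hasDerivAt_one_sub_exp_mul {β : ℝ} (hβ : β ≠ 0) (r : ℝ) :
    HasDerivAt (fun r => (1 - Real.exp (-β * r) * (1 + β * r)) / β ^ 2)
      (r * Real.exp (-β * r)) r := by
  have h1 : HasDerivAt (fun r => Real.exp (-β * r)) (Real.exp (-β * r) * (-β)) r := by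
    simpa using ((hasDerivAt_id r).const_mul (-β)).exp
  have h2 : HasDerivAt (fun r => 1 + β * r) β r := by
    simpa using ((hasDerivAt_id r).const_mul β).const_add 1
  refine (((h1.mul h2).const_sub 1).div_const (β ^ 2)).congr_deriv ?_
  field_simp
  ring

lemma setLIntegral_mul_exp {β : ℝ} (hβ : 0 < β) {R : ℝ} (hR : 0 ≤ R) :
    ∫⁻ r in Set.Ioc 0 R, ENNReal.ofReal (r * Real.exp (-β * r)) =
      ENNReal.ofReal ((1 - Real.exp (-β * R) * (1 + β * R)) / β ^ 2) := by
  rw [setLIntegral_ofReal_deriv hR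
    (fun r _ => (hasDerivAt_one_sub_exp_mul hβ.ne' r).continuousAt.continuousWithinAt)
    (fun r _ => hasDerivAt_one_sub_exp_mul hβ.ne' r)
    fun r hr => mul_nonneg hr.1.le (Real.exp_nonneg _)]
  simp

lemma one_sub_exp_nonneg {β r : ℝ} (hβ : 0 < β) (hr : 0 ≤ r) : 0 ≤ 1 - Real.exp (-β * r) := by
  rw [sub_nonneg, Real.exp_le_one_iff]
  nlinarith

lemma hasDerivAt_sq_half_sub {β : ℝ} (hβ : β ≠ 0) (r : ℝ) :
    HasDerivAt (fun r => r ^ 2 / 2 - (1 - Real.exp (-β * r) * (1 + β * r)) / β ^ 2)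
      (r * (1 - Real.exp (-β * r))) r := by
  refine (((hasDerivAt_pow 2 r).div_const 2).sub
    (hasDerivAt_one_sub_exp_mul hβ r)).congr_deriv ?_
  simp; ring

lemma sq_half_sub_nonneg {β : ℝ} (hβ : 0 < β) {R : ℝ} (hR : 0 ≤ R) :
    0 ≤ R ^ 2 / 2 - (1 - Real.exp (-β * R) * (1 + β * R)) / β ^ 2 := by
  have hmono : MonotoneOn (fun r => r ^ 2 / 2 - (1 - Real.exp (-β * r) * (1 + β * r)) / β ^ 2)
      (Set.Ici 0) := by
    refine monotoneOn_of_hasDerivWithinAt_nonneg (convex_Ici 0)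
      (fun r _ => (hasDerivAt_sq_half_sub hβ.ne' r).continuousAt.continuousWithinAt)
      (fun r _ => (hasDerivAt_sq_half_sub hβ.ne' r).hasDerivWithinAt) fun r hr => ?_
    rw [interior_Ici] at hr
    exact mul_nonneg (le_of_lt hr) (one_sub_exp_nonneg hβ (le_of_lt hr))
  simpa using hmono Set.self_mem_Ici hR hR

lemma setLIntegral_mul_one_sub_exp {β : ℝ} (hβ : 0 < β) {R : ℝ} (hR : 0 ≤ R) :
    ∫⁻ r in Set.Ioc 0 R, ENNReal.ofReal (r * (1 - Real.exp (-β * r))) =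
      ENNReal.ofReal (R ^ 2 / 2 - (1 - Real.exp (-β * R) * (1 + β * R)) / β ^ 2) := by
  rw [setLIntegral_ofReal_deriv hR
    (fun r _ => (hasDerivAt_sq_half_sub hβ.ne' r).continuousAt.continuousWithinAt)
    (fun r _ => hasDerivAt_sq_half_sub hβ.ne' r) fun r hr =>
    mul_nonneg hr.1.le (one_sub_exp_nonneg hβ hr.1.le)]
  simp

lemma setLIntegral_mul_indicator_rpow_lt {α y : ℝ} (hα : 0 < α) (hy : 0 ≤ y) (g : ℝ → ℝ≥0∞) :
    ∫⁻ r in Set.Ioi (0 : ℝ), (if r ^ α < y then g r else 0) =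
      ∫⁻ r in Set.Ioc 0 (y ^ (1 / α)), g r := by
  rw [← restrict_Ioo_eq_restrict_Ioc, ← lintegral_indicator measurableSet_Ioi,
    ← lintegral_indicator measurableSet_Ioo]
  refine lintegral_congr fun r => ?_
  by_cases hr : 0 < r
  · have : r ^ α < y ↔ r < y ^ (1 / α) := by
      rw [one_div]; exact (Real.lt_rpow_inv_iff_of_pos hr.le hy hα).symm
    simp only [Set.indicator, Set.mem_Ioi, Set.mem_Ioo, hr, true_and, this, if_true]
  · simp [Set.indicator, hr]

/-! ### The transmit power of a typical user -/

namespace Network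

variable {K : ℕ} (net : Network K)

lemma Lam_eq (k : Fin K) {y : ℝ} (hy : 0 ≤ y) :
    net.Lam k y = 2 * Real.pi * net.lam k *
      ((1 - Real.exp (-net.β k * y ^ (1 / net.αL k)) * (1 + net.β k * y ^ (1 / net.αL k))) /
          net.β k ^ 2 +
        ((y ^ (1 / net.αN k)) ^ 2 / 2 -
          (1 - Real.exp (-net.β k * y ^ (1 / net.αN k)) * (1 + net.β k * y ^ (1 / net.αN k))) /
          net.β k ^ 2)) := by
  rw [Lam, show (y ^ (2 / net.αN k) : ℝ) = (y ^ (1 / net.αN k)) ^ 2 by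
    rw [← Real.rpow_natCast, ← Real.rpow_mul hy]; congr 1; push_cast; ring]
  ring

lemma one_sub_exp_mul_one_add_pos {z : ℝ} (hz : 0 < z) :
    0 < 1 - Real.exp (-z) * (1 + z) := by
  rw [sub_pos, Real.exp_neg, inv_mul_lt_one₀ (Real.exp_pos _), add_comm]
  exact Real.add_one_lt_exp hz.ne'

lemma Lam_pos (k : Fin K) {y : ℝ} (hy : 0 < y) : 0 < net.Lam k y := by
  have hβ := net.β_pos k
  have hl := net.lam_pos k
  have h1 := one_sub_exp_mul_one_add_pos (mul_pos hβ (Real.rpow_pos_of_pos hy (1 / net.αL k)))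
  rw [← neg_mul] at h1
  rw [net.Lam_eq k hy.le]
  exact mul_pos (by positivity) (add_pos_of_pos_of_nonneg (by positivity)
    (sq_half_sub_nonneg hβ (Real.rpow_nonneg hy.le _)))

lemma Lam_zero (k : Fin K) : net.Lam k 0 = 0 := by
  have h1 := (net.αL_pos k).ne'
  have h2 := (net.αN_pos k).ne'
  rw [net.Lam_eq k le_rfl]
  simp [Real.zero_rpow, h1, h2]

lemma Lam_nonneg (k : Fin K) {y : ℝ} (hy : 0 ≤ y) : 0 ≤ net.Lam k y := by
  rcases hy.eq_or_lt with rfl | hy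
  · rw [Lam_zero]
  · exact (net.Lam_pos k hy).le

lemma continuous_Lam (k : Fin K) : Continuous (net.Lam k) := by
  have h1 : Continuous fun y : ℝ => y ^ (1 / net.αL k) :=
    continuous_id.rpow_const fun _ => Or.inr (one_div_nonneg.2 (net.αL_pos k).le)
  have h2 : Continuous fun y : ℝ => y ^ (1 / net.αN k) :=
    continuous_id.rpow_const fun _ => Or.inr (one_div_nonneg.2 (net.αN_pos k).le)
  have h3 : Continuous fun y : ℝ => y ^ (2 / net.αN k) :=
    continuous_id.rpow_const fun _ => Or.inr (div_nonneg two_pos.le (net.αN_pos k).le)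
  unfold Lam
  fun_prop

lemma lamBar_nonneg (j k : Fin K) {p : ℝ} (hp : 0 < p) : 0 ≤ net.lamBar j k p := by
  have hρ := net.ρ_pos j
  have hl := net.lam_pos k
  have hL := net.αL_pos k
  have hN := net.αN_pos k
  have := one_sub_exp_nonneg (net.β_pos k) (Real.rpow_nonneg (div_pos hp hρ).le (1 / net.αN k))
  unfold lamBar
  positivity

lemma hasDerivAt_Lam_div (j k : Fin K) {p : ℝ} (hp : 0 < p) :
    HasDerivAt (fun p => net.Lam k (p / net.ρ j)) (net.lamBar j k p) p := by
  have hρ := net.ρ_pos j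
  have hβ := net.β_pos k
  have hL := net.αL_pos k
  have hN := net.αN_pos k
  have hr : ∀ α : ℝ, HasDerivAt (fun p : ℝ => (p / net.ρ j) ^ (1 / α))
      (1 / net.ρ j * (1 / α) * (p / net.ρ j) ^ (1 / α - 1)) p := fun α =>
    ((hasDerivAt_id p).div_const (net.ρ j)).rpow_const (Or.inl (div_pos hp hρ).ne')
  -- The density of the radius in polar coordinates, in terms of the path loss.
  have hpow : ∀ α : ℝ, (p / net.ρ j) ^ (1 / α) *
      (1 / net.ρ j * (1 / α) * (p / net.ρ j) ^ (1 / α - 1)) =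
      1 / (α * net.ρ j ^ (2 / α)) * p ^ (2 / α - 1) := fun α => by
    rw [show (2 / α : ℝ) = 1 / α + 1 / α by ring, Real.rpow_sub (div_pos hp hρ), Real.rpow_one,
      Real.rpow_sub hp, Real.rpow_one, Real.rpow_add hp, Real.rpow_add hρ,
      Real.div_rpow hp.le hρ.le]
    have := (Real.rpow_pos_of_pos hρ (1 / α)).ne'
    field_simp
  have h := (((hasDerivAt_one_sub_exp_mul hβ.ne' _).comp p (hr (net.αL k))).add
    ((hasDerivAt_sq_half_sub hβ.ne' _).comp p (hr (net.αN k)))).const_mul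
      (2 * Real.pi * net.lam k)
  refine (h.congr_of_eventuallyEq ?_).congr_deriv ?_
  · filter_upwards [lt_mem_nhds hp] with q hq
    exact net.Lam_eq k (div_pos hq hρ).le
  · have e1 := hpow (net.αL k)
    have e2 := hpow (net.αN k)
    rw [lamBar]
    linear_combination (2 * Real.pi * net.lam k) *
      (Real.exp (-net.β k * (p / net.ρ j) ^ (1 / net.αL k)) * e1 +
        (1 - Real.exp (-net.β k * (p / net.ρ j) ^ (1 / net.αN k))) * e2)

open Classical in
/-- `Λ_k (y)` is the intensity of the tier-`k` base stations with path loss below `y`. -/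
lemma lintegral_loss_lt (k : Fin K) {y : ℝ} (hy : 0 ≤ y) :
    ∫⁻ x : Plane, ∫⁻ u, (if (if IsLOS (net.β k) ‖x‖ u then ‖x‖ ^ net.αL k else ‖x‖ ^ net.αN k) < y
      then 1 else 0) ∂uniformLaw ∂(ENNReal.ofReal (net.lam k) • volume) =
      ENNReal.ofReal (net.Lam k y) := by
  have hβ := net.β_pos k
  have hl := net.lam_pos k
  have hyL : 0 ≤ y ^ (1 / net.αL k) := Real.rpow_nonneg hy _
  have hyN : 0 ≤ y ^ (1 / net.αN k) := Real.rpow_nonneg hy _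
  have h1 : ∀ x : Plane, ∫⁻ u, (if (if IsLOS (net.β k) ‖x‖ u then ‖x‖ ^ net.αL k
      else ‖x‖ ^ net.αN k) < y then (1 : ℝ≥0∞) else 0) ∂uniformLaw =
      ENNReal.ofReal (Real.exp (-net.β k * ‖x‖)) * (if ‖x‖ ^ net.αL k < y then 1 else 0) +
      ENNReal.ofReal (1 - Real.exp (-net.β k * ‖x‖)) * (if ‖x‖ ^ net.αN k < y then 1 else 0) :=
    fun x => by
      rw [← lintegral_uniformLaw_isLOS hβ (norm_nonneg x)]
      refine lintegral_congr fun u => ?_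
      split_ifs <;> rfl
  have hind : ∀ α : ℝ, Measurable fun r : ℝ => if r ^ α < y then (1 : ℝ≥0∞) else 0 := fun α =>
    Measurable.ite (measurableSet_lt (by fun_prop) measurable_const) measurable_const measurable_const
  have hm := hind (net.αL k)
  have hm' := hind (net.αN k)
  simp_rw [h1]
  rw [lintegral_smul_measure, smul_eq_mul, lintegral_norm_plane (f := fun r =>
    ENNReal.ofReal (Real.exp (-net.β k * r)) * (if r ^ net.αL k < y then 1 else 0) +
      ENNReal.ofReal (1 - Real.exp (-net.β k * r)) * (if r ^ net.αN k < y then 1 else 0))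
    (by fun_prop)]
  have h2 : ∫⁻ r in Set.Ioi (0 : ℝ), ENNReal.ofReal r *
      (ENNReal.ofReal (Real.exp (-net.β k * r)) * (if r ^ net.αL k < y then 1 else 0) +
      ENNReal.ofReal (1 - Real.exp (-net.β k * r)) * (if r ^ net.αN k < y then 1 else 0)) =
      ∫⁻ r in Set.Ioi (0 : ℝ),
        ((if r ^ net.αL k < y then ENNReal.ofReal (r * Real.exp (-net.β k * r)) else 0) +
        (if r ^ net.αN k < y then ENNReal.ofReal (r * (1 - Real.exp (-net.β k * r))) else 0)) := by
    refine setLIntegral_congr_fun measurableSet_Ioi fun r (hr : 0 < r) => ?_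
    simp only [mul_add, ← ENNReal.ofReal_mul hr.le, mul_ite, mul_one, mul_zero]
  have hm2 : Measurable fun r : ℝ =>
      if r ^ net.αL k < y then ENNReal.ofReal (r * Real.exp (-net.β k * r)) else 0 :=
    Measurable.ite (measurableSet_lt (by fun_prop) measurable_const) (by fun_prop) measurable_const
  rw [h2, lintegral_add_left hm2, setLIntegral_mul_indicator_rpow_lt (net.αL_pos k) hy,
    setLIntegral_mul_indicator_rpow_lt (net.αN_pos k) hy, setLIntegral_mul_exp hβ hyL,
    setLIntegral_mul_one_sub_exp hβ hyN, ← ENNReal.ofReal_add, ← ENNReal.ofReal_mul (by positivity),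
    ← ENNReal.ofReal_mul hl.le]
  · rw [net.Lam_eq k hy]
    congr 1
    ring
  · refine div_nonneg (sub_nonneg.2 ?_) (sq_nonneg _)
    rw [neg_mul, Real.exp_neg, inv_mul_le_one₀ (Real.exp_pos _), add_comm]
    exact Real.add_one_le_exp _
  · exact sq_half_sub_nonneg hβ hyN

end Network

lemma sigmaFinite_ofReal_smul_volume (d : ℝ) :
    SigmaFinite (ENNReal.ofReal d • (volume : Measure Plane)) :=
  inferInstanceAs (SigmaFinite (d.toNNReal • (volume : Measure Plane)))

namespace BaseStations

variable {K : ℕ} {Ω : Type*} {bs : BaseStations K Ω} {net : Network K}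

lemma loss_nonneg (k : Fin K) (i : ℕ) (ω : Ω) : 0 ≤ bs.loss net k i ω := by
  unfold loss
  split_ifs <;> positivity

/-- The infimum `minLoss` is a genuine one: there is a base station, and path losses are nonnegative. -/
lemma le_minLoss_iff [Nonempty (Fin K)] {y : ℝ} {ω : Ω} :
    y ≤ bs.minLoss net ω ↔ ∀ k i, y ≤ bs.loss net k i ω := by
  rw [minLoss, le_ciInf_iff ⟨0, by rintro _ ⟨q, rfl⟩; exact loss_nonneg q.1 q.2 ω⟩]
  exact Prod.forall

lemma minLoss_nonneg (ω : Ω) : 0 ≤ bs.minLoss net ω :=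
  Real.iInf_nonneg fun q => loss_nonneg q.1 q.2 ω

variable [MeasurableSpace Ω] {P : Measure Ω}

lemma IsModel.measurable_loss (h : bs.IsModel net P) (k : Fin K) (i : ℕ) :
    Measurable (bs.loss net k i) := by
  have h1 := (h.loc_ppp k).measurable i
  exact Measurable.ite (((measurableSet_isLOS (net.β k)).preimage (h1.prodMk (h.blk_meas k i))))
    (by fun_prop) (by fun_prop)

lemma IsModel.measurable_minLoss (h : bs.IsModel net P) : Measurable (bs.minLoss net) :=
  Measurable.iInf fun q => h.measurable_loss q.1 q.2

lemma IsModel.sigma_le (h : bs.IsModel net P) (s : BSSource K) :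
    bs.sigma s ≤ ‹MeasurableSpace Ω› := by
  cases s with
  | loc k => exact iSup_le fun i => ((h.loc_ppp k).measurable i).comap_le
  | blk k i => exact (h.blk_meas k i).comap_le

open Classical in
/-- No base station has a path loss below `y` with probability `exp (-∑ Λ_k (y))`: a void probability
of a marked Poisson process, that is, its Laplace functional at a function with values `0` and `∞`. -/
theorem IsModel.measure_le_minLoss [IsProbabilityMeasure P] [Nonempty (Fin K)]
    (h : bs.IsModel net P) {y : ℝ} (hy : 0 ≤ y) :
    P {ω | y ≤ bs.minLoss net ω} = ENNReal.ofReal (Real.exp (-∑ k, net.Lam k y)) := by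
  let c : Fin K → Plane × ℝ → ℝ≥0∞ := fun k t =>
    if (if IsLOS (net.β k) ‖t.1‖ t.2 then ‖t.1‖ ^ net.αL k else ‖t.1‖ ^ net.αN k) < y then ∞ else 0
  have hc : ∀ k, Measurable (c k) := fun k => by
    refine Measurable.ite (measurableSet_lt ?_ measurable_const) measurable_const measurable_const
    exact Measurable.ite (measurableSet_isLOS (net.β k)) (by fun_prop) (by fun_prop)
  have hlocL : ∀ k i, Measurable[bs.sigma (.loc k)] (bs.loc k i) := fun k i =>
    Measurable.of_comap_le (le_iSup (fun i => MeasurableSpace.comap (bs.loc k i) inferInstance) i)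
  have := fun k => sigmaFinite_ofReal_smul_volume (net.lam k)
  have key := lintegral_eneg_marked_poisson h.sigma_le h.indep h.loc_ppp h.blk_law
    (l := BSSource.loc) (fun a b hab => by simpa using hab) hlocL
    (T := fun k i => {BSSource.blk k i}) (by simp)
    (fun q q' hq => Set.disjoint_singleton.2 fun heq => hq (by
      simp only [BSSource.blk.injEq] at heq; exact Prod.ext heq.1 heq.2))
    (fun k i => Measurable.of_comap_le (le_iSup₂_of_le (BSSource.blk k i) rfl le_rfl)) hc
  have hL : ∀ ω, eneg (∑ k, ∑' i, c k (bs.loc k i ω, bs.blk k i ω)) =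
      {ω | y ≤ bs.minLoss net ω}.indicator 1 ω := fun ω => by
    by_cases hω : y ≤ bs.minLoss net ω
    · rw [Set.indicator_of_mem (show ω ∈ {ω | y ≤ bs.minLoss net ω} from hω)]
      have h0 : ∀ k i, c k (bs.loc k i ω, bs.blk k i ω) = 0 := fun k i =>
        if_neg (not_lt.2 (le_minLoss_iff.1 hω k i))
      simp [h0]
    · rw [Set.indicator_of_notMem (show ω ∉ {ω | y ≤ bs.minLoss net ω} from hω)]
      rw [le_minLoss_iff] at hω
      push Not at hω
      obtain ⟨k, i, hki⟩ := hω
      have hinf : c k (bs.loc k i ω, bs.blk k i ω) = ∞ := if_pos hki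
      have htop : ∑ k, ∑' i, c k (bs.loc k i ω, bs.blk k i ω) = ∞ :=
        ENNReal.sum_eq_top.2 ⟨k, Finset.mem_univ k, ENNReal.tsum_eq_top_of_eq_top ⟨i, hinf⟩⟩
      rw [htop, eneg_top]
  have hR : ∀ k, ∫⁻ x, ∫⁻ u, (1 - eneg (c k (x, u))) ∂uniformLaw
      ∂(ENNReal.ofReal (net.lam k) • volume) = ENNReal.ofReal (net.Lam k y) := fun k => by
    rw [← net.lintegral_loss_lt k hy]
    refine lintegral_congr fun x => lintegral_congr fun u => ?_
    simp only [c]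
    split_ifs <;> simp
  simp_rw [hL, hR] at key
  rw [lintegral_indicator_one (measurableSet_le measurable_const h.measurable_minLoss)] at key
  rw [key, ← ENNReal.ofReal_sum_of_nonneg fun k _ => net.Lam_nonneg k hy,
    eneg_ofReal (Finset.sum_nonneg fun k _ => net.Lam_nonneg k hy)]

/-- The strict version, by right continuity: the law of `minLoss` has no atoms. -/
lemma IsModel.measure_lt_minLoss [IsProbabilityMeasure P] [Nonempty (Fin K)]
    (h : bs.IsModel net P) {y : ℝ} (hy : 0 ≤ y) :
    P {ω | y < bs.minLoss net ω} = ENNReal.ofReal (Real.exp (-∑ k, net.Lam k y)) := by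
  refine le_antisymm ?_ ?_
  · rw [← h.measure_le_minLoss hy]
    exact measure_mono fun ω (hω : y < _) => hω.le
  · have hc : Continuous fun z => ENNReal.ofReal (Real.exp (-∑ k, net.Lam k z)) :=
      ENNReal.continuous_ofReal.comp (Real.continuous_exp.comp
        (continuous_finsetSum _ fun k _ => net.continuous_Lam k).neg)
    refine le_of_tendsto ((hc.tendsto y).mono_left (nhdsWithin_le_nhds (s := Set.Ioi y))) ?_
    filter_upwards [self_mem_nhdsWithin] with z (hz : y < z)
    rw [← h.measure_le_minLoss (hy.trans hz.le)]
    exact measure_mono fun ω (hω : z ≤ _) => hz.trans_le hω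

lemma IsModel.measurable_power (h : bs.IsModel net P) (k : Fin K) : Measurable (bs.power net k) :=
  h.measurable_minLoss.const_mul _

lemma IsModel.measure_power_le [IsProbabilityMeasure P] (h : bs.IsModel net P) (k : Fin K) {t : ℝ}
    (ht : 0 ≤ t) : P {ω | bs.power net k ω ≤ t} =
      ENNReal.ofReal (1 - Real.exp (-∑ a, net.Lam a (t / net.ρ k))) := by
  have : Nonempty (Fin K) := ⟨k⟩
  have hρ := net.ρ_pos k
  have hset : {ω | bs.power net k ω ≤ t} = {ω | t / net.ρ k < bs.minLoss net ω}ᶜ := by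
    ext ω
    simp only [power, Set.mem_ofPred_eq, Set.mem_compl_iff, not_lt, le_div_iff₀' hρ]
  rw [hset, prob_compl_eq_one_sub (measurableSet_lt measurable_const h.measurable_minLoss),
    h.measure_lt_minLoss (by positivity), ENNReal.ofReal_sub _ (Real.exp_nonneg _),
    ENNReal.ofReal_one]

end BaseStations

namespace Network

variable {K : ℕ} (net : Network K)

lemma sum_Lam_pos (k : Fin K) {y : ℝ} (hy : 0 < y) : 0 < ∑ a, net.Lam a y :=
  Finset.sum_pos (fun a _ => net.Lam_pos a hy) ⟨k, Finset.mem_univ k⟩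

lemma one_sub_exp_Lam_pos (k : Fin K) :
    0 < 1 - Real.exp (-∑ a, net.Lam a (net.Pu / net.ρ k)) := by
  rw [sub_pos, Real.exp_lt_one_iff, neg_lt_zero]
  exact net.sum_Lam_pos k (div_pos net.Pu_pos (net.ρ_pos k))

lemma powerPDF_nonneg (k : Fin K) {p : ℝ} (hp : 0 < p) : 0 ≤ net.powerPDF k p :=
  mul_nonneg (div_nonneg (Finset.sum_nonneg fun a _ => net.lamBar_nonneg k a hp)
    (net.one_sub_exp_Lam_pos k).le) (Real.exp_nonneg _)

lemma measurable_powerPDF (k : Fin K) : Measurable (net.powerPDF k) := by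
  unfold powerPDF lamBar Lam
  fun_prop

lemma setLIntegral_powerPDF (k : Fin K) {t : ℝ} (ht : 0 ≤ t) :
    ∫⁻ p in Set.Ioc 0 t, ENNReal.ofReal (net.powerPDF k p) =
      ENNReal.ofReal ((1 - Real.exp (-∑ a, net.Lam a (t / net.ρ k))) /
        (1 - Real.exp (-∑ a, net.Lam a (net.Pu / net.ρ k)))) := by
  have hc : Continuous fun p => (1 - Real.exp (-∑ a, net.Lam a (p / net.ρ k))) /
      (1 - Real.exp (-∑ a, net.Lam a (net.Pu / net.ρ k))) :=
    (continuous_const.sub (Real.continuous_exp.comp (continuous_finsetSum _ fun a _ =>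
      (net.continuous_Lam a).comp (continuous_id.div_const _)).neg)).div_const _
  rw [setLIntegral_ofReal_deriv ht hc.continuousOn (fun p hp => ?_)
    fun p hp => net.powerPDF_nonneg k hp.1]
  · simp [Lam_zero]
  · refine ((((HasDerivAt.fun_sum fun a _ => net.hasDerivAt_Lam_div k a hp.1).neg.exp).const_sub
      1).div_const _).congr_deriv ?_
    rw [powerPDF, Pi.neg_apply]
    ring

end Network

namespace BaseStations

/-- The transmit power of a typical active user has density `powerPDF`. -/
theorem IsModel.powerLaw_eq {K : ℕ} {Ω : Type*} [MeasurableSpace Ω] {bs : BaseStations K Ω}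
    {net : Network K} {P : Measure Ω} [IsProbabilityMeasure P] (h : bs.IsModel net P) (k : Fin K) :
    bs.powerLaw net P k = (volume.restrict (Set.Ioc 0 net.Pu)).withDensity
      fun p => ENNReal.ofReal (net.powerPDF k p) := by
  have hm := h.measurable_power k
  have hPu := net.Pu_pos
  have hc := net.one_sub_exp_Lam_pos k
  have hmS : MeasurableSet {ω | bs.power net k ω ≤ net.Pu} := measurableSet_le hm measurable_const
  have : IsFiniteMeasure (bs.powerLaw net P k) := by unfold powerLaw; infer_instance
  refine Measure.ext_of_Iic _ _ fun t => ?_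
  rw [powerLaw, Measure.map_apply hm measurableSet_Iic, cond_apply hmS,
    withDensity_apply _ measurableSet_Iic, Measure.restrict_restrict measurableSet_Iic]
  have hset : {ω | bs.power net k ω ≤ net.Pu} ∩ bs.power net k ⁻¹' Set.Iic t =
      {ω | bs.power net k ω ≤ min net.Pu t} := by
    ext ω; simp
  have hset' : Set.Iic t ∩ Set.Ioc 0 net.Pu = Set.Ioc 0 (min net.Pu t) := by
    ext p; simp only [Set.mem_inter_iff, Set.mem_Iic, Set.mem_Ioc, le_min_iff]; tauto
  rw [hset, hset']
  rcases lt_or_ge t 0 with ht | ht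
  · have h1 : {ω | bs.power net k ω ≤ min net.Pu t} = ∅ := by
      refine Set.eq_empty_of_forall_notMem fun ω hω => ?_
      have hω : bs.power net k ω ≤ min net.Pu t := hω
      have := mul_nonneg (net.ρ_pos k).le (minLoss_nonneg (bs := bs) (net := net) ω)
      exact absurd (hω.trans (min_le_right _ _)) (not_le.2 (ht.trans_le this))
    rw [h1, Set.Ioc_eq_empty (by simp [ht.le])]
    simp
  · have ht' : 0 ≤ min net.Pu t := le_min hPu.le ht
    rw [h.measure_power_le k hPu.le, h.measure_power_le k ht', net.setLIntegral_powerPDF k ht',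
      ENNReal.ofReal_div_of_pos hc, mul_comm, ENNReal.div_eq_inv_mul, mul_comm]

end BaseStations

/-! ### The interference as a functional of a marked Poisson process -/

open Classical in
/-- Contribution to the interference at a base station of tier `j` of a tier-`k` user at `x` with
marks `(p, g, u, f)`: transmit power, directivity gain, blockage variable and fading. -/
noncomputable def contribution {K : ℕ} (net : Network K) (j k : Fin K)
    (t : Plane × ℝ × ℝ × ℝ × ℝ) : ℝ≥0∞ :=
  if IsLOS (net.β j) ‖t.1‖ t.2.2.2.1 then
    if t.2.1 * ‖t.1‖ ^ (-net.αL j) < net.ρ k then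
      ENNReal.ofReal (t.2.1 * t.2.2.1 * t.2.2.2.2 * ‖t.1‖ ^ (-net.αL j)) else 0
  else
    if t.2.1 * ‖t.1‖ ^ (-net.αN j) < net.ρ k then
      ENNReal.ofReal (t.2.1 * t.2.2.1 * t.2.2.2.2 * ‖t.1‖ ^ (-net.αN j)) else 0

lemma measurable_contribution {K : ℕ} (net : Network K) (j k : Fin K) :
    Measurable (contribution net j k) := by
  have h1 : MeasurableSet {t : Plane × ℝ × ℝ × ℝ × ℝ | IsLOS (net.β j) ‖t.1‖ t.2.2.2.1} :=
    (measurableSet_isLOS (net.β j)).preimage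
      (f := fun t : Plane × ℝ × ℝ × ℝ × ℝ => (t.1, t.2.2.2.1)) (by fun_prop)
  refine Measurable.ite h1 ?_ ?_ <;>
  exact Measurable.ite (measurableSet_lt (by fun_prop) measurable_const) (by fun_prop)
    measurable_const

namespace Uplink

variable {K : ℕ} {Ω : Type*} {up : Uplink K Ω} {net : Network K} {j : Fin K}

/-- The marks of the interfering users: transmit power, directivity gain, blockage, fading. -/
def marks (up : Uplink K Ω) (k : Fin K) (i : ℕ) (ω : Ω) : ℝ × ℝ × ℝ × ℝ :=
  (up.pow k i ω, up.dir k i ω, up.blk k i ω, up.fad k i ω)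

lemma noiseInterference_eq (ω : Ω) : up.noiseInterference net j ω =
    ENNReal.ofReal (net.σ ^ 2) +
      ∑ k, ∑' i, contribution net j k (up.loc k i ω, up.marks k i ω) := by
  rw [noiseInterference, add_assoc, ← Finset.sum_add_distrib]
  congr 1
  refine Finset.sum_congr rfl fun k _ => ?_
  rw [interferenceL, interferenceN, ← ENNReal.tsum_add]
  refine tsum_congr fun i => ?_
  by_cases hl : IsLOS (net.β j) ‖up.loc k i ω‖ (up.blk k i ω) <;>
    simp only [contribution, marks, received, hl, if_true, if_false, add_zero, zero_add] <;>
    exact if_congr Iff.rfl rfl rfl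

lemma measurable_noiseInterference [MeasurableSpace Ω] (hloc : ∀ k i, Measurable (up.loc k i))
    (hmarks : ∀ k i, Measurable (up.marks k i)) : Measurable (up.noiseInterference net j) := by
  rw [funext fun ω => noiseInterference_eq (up := up) (net := net) (j := j) ω]
  exact measurable_const.add (Finset.measurable_fun_sum _ fun k _ => Measurable.tsum fun i =>
    (measurable_contribution net j k).comp ((hloc k i).prodMk (hmarks k i)))

/-- The sources of randomness of the marks of an interfering user. -/
def markSources (k : Fin K) (i : ℕ) : Set (ULSource K) :=
  {.pow k i, .dir k i, .blk k i, .fad k i}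

lemma measurable_iSup_sigma {E : Type*} [mE : MeasurableSpace E] {A : Set (ULSource K)}
    {s : ULSource K} (hs : s ∈ A) {Y : Ω → E} (hY : mE.comap Y ≤ up.sigma s) :
    Measurable[⨆ s ∈ A, up.sigma s] Y :=
  Measurable.of_comap_le (le_iSup₂_of_le s hs hY)

lemma measurable_marks {A : Set (ULSource K)} {k : Fin K} {i : ℕ} (hA : markSources k i ⊆ A) :
    Measurable[⨆ s ∈ A, up.sigma s] (up.marks k i) :=
  (measurable_iSup_sigma (s := .pow k i) (hA (by simp [markSources])) le_rfl).prodMk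
    ((measurable_iSup_sigma (s := .dir k i) (hA (by simp [markSources])) le_rfl).prodMk
      ((measurable_iSup_sigma (s := .blk k i) (hA (by simp [markSources])) le_rfl).prodMk
        (measurable_iSup_sigma (s := .fad k i) (hA (by simp [markSources])) le_rfl)))

lemma comap_loc_le (k : Fin K) (i : ℕ) :
    MeasurableSpace.comap (up.loc k i) inferInstance ≤ up.sigma (.loc k) :=
  le_iSup (fun i => MeasurableSpace.comap (up.loc k i) inferInstance) i

variable [MeasurableSpace Ω] {P : Measure Ω} {pl : Fin K → Measure ℝ}

lemma IsModel.sigma_le (h : up.IsModel net j pl P) (s : ULSource K) :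
    up.sigma s ≤ ‹MeasurableSpace Ω› := by
  cases s with
  | desired => exact h.desired_meas.comap_le
  | loc k => exact iSup_le fun i => ((h.loc_ppp k).measurable i).comap_le
  | pow k i => exact (h.pow_meas k i).comap_le
  | fad k i => exact (h.fad_meas k i).comap_le
  | dir k i => exact (h.dir_meas k i).comap_le
  | blk k i => exact (h.blk_meas k i).comap_le

lemma IsModel.map_prodMk [IsProbabilityMeasure P] (h : up.IsModel net j pl P) {E F : Type*}
    [MeasurableSpace E] [MeasurableSpace F] {A B : Set (ULSource K)} (hAB : Disjoint A B)
    {Y : Ω → E} {Z : Ω → F} (hY : Measurable[⨆ s ∈ A, up.sigma s] Y)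
    (hZ : Measurable[⨆ s ∈ B, up.sigma s] Z) :
    P.map (fun ω => (Y ω, Z ω)) = (P.map Y).prod (P.map Z) := by
  have hle : ∀ A : Set (ULSource K), ⨆ s ∈ A, up.sigma s ≤ ‹MeasurableSpace Ω› :=
    fun A => iSup₂_le fun s _ => h.sigma_le s
  have hI : IndepFun Y Z P := indep_of_indep_of_le_left (indep_of_indep_of_le_right
    (indep_iSup_of_disjoint h.sigma_le h.indep hAB) hZ.comap_le) hY.comap_le
  exact hI.map_prod_eq_prod_map_map (hY.mono (hle _) le_rfl).aemeasurable
    (hZ.mono (hle _) le_rfl).aemeasurable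

lemma IsModel.map_marks [IsProbabilityMeasure P] (h : up.IsModel net j pl P) (k : Fin K) (i : ℕ) :
    P.map (up.marks k i) =
      (pl k).prod ((net.gainLaw j).prod (uniformLaw.prod net.fadingLaw)) := by
  have hp := measurable_iSup_sigma (up := up) (Set.mem_singleton (ULSource.pow k i)) le_rfl
  have hd := measurable_iSup_sigma (up := up) (Set.mem_singleton (ULSource.dir k i)) le_rfl
  have hb := measurable_iSup_sigma (up := up) (Set.mem_singleton (ULSource.blk k i)) le_rfl
  have hf := measurable_iSup_sigma (up := up) (Set.mem_singleton (ULSource.fad k i)) le_rfl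
  have hbf : Measurable[⨆ s ∈ ({.blk k i, .fad k i} : Set (ULSource K)), up.sigma s]
      fun ω => (up.blk k i ω, up.fad k i ω) :=
    (measurable_iSup_sigma (s := .blk k i) (by simp) le_rfl).prodMk
      (measurable_iSup_sigma (s := .fad k i) (by simp) le_rfl)
  have hdbf : Measurable[⨆ s ∈ ({.dir k i, .blk k i, .fad k i} : Set (ULSource K)), up.sigma s]
      fun ω => (up.dir k i ω, up.blk k i ω, up.fad k i ω) :=
    (measurable_iSup_sigma (s := .dir k i) (by simp) le_rfl).prodMk
      ((measurable_iSup_sigma (s := .blk k i) (by simp) le_rfl).prodMk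
        (measurable_iSup_sigma (s := .fad k i) (by simp) le_rfl))
  rw [← h.pow_law k i, ← h.dir_law k i, ← h.blk_law k i, ← h.fad_law k i,
    ← h.map_prodMk (by simp) hb hf, ← h.map_prodMk (by simp) hd hbf,
    ← h.map_prodMk (by simp) hp hdbf]
  rfl

/-- The Laplace transform of noise plus interference. -/
theorem IsModel.lintegral_eneg_noiseInterference [IsProbabilityMeasure P]
    (h : up.IsModel net j pl P) (s : ℝ≥0∞) :
    ∫⁻ ω, eneg (s * up.noiseInterference net j ω) ∂P =
      eneg (s * ENNReal.ofReal (net.σ ^ 2) + ∑ k, ∫⁻ x, ∫⁻ t,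
        (1 - eneg (s * contribution net j k (x, t)))
          ∂((pl k).prod ((net.gainLaw j).prod (uniformLaw.prod net.fadingLaw)))
          ∂(ENNReal.ofReal (net.lam k) • volume)) := by
  have := fun k => sigmaFinite_ofReal_smul_volume (net.lam k)
  have key := lintegral_eneg_marked_poisson h.sigma_le h.indep h.loc_ppp h.map_marks
    (l := ULSource.loc) (fun a b hab => by simpa using hab)
    (fun k i => Measurable.of_comap_le (comap_loc_le k i))
    (T := markSources) (by simp [markSources])
    (fun q q' hq => by
      have hne : ¬ (q.1 = q'.1 ∧ q.2 = q'.2) := fun heq => hq (Prod.ext heq.1 heq.2)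
      simp [Function.onFun, markSources, eq_comm]
      tauto)
    (fun k i => measurable_marks subset_rfl)
    (c := fun k t => s * contribution net j k t)
    (fun k => (measurable_contribution net j k).const_mul s)
  simp_rw [noiseInterference_eq, mul_add, eneg_add, Finset.mul_sum, ← ENNReal.tsum_mul_left]
  rw [lintegral_const_mul', key]
  exact eneg_ne_top _

end Uplink

/-! ### Averaging the contribution of an interfering user over its marks -/

open Classical in
/-- Mean of `1 - exp (-c)` over the fading of a link of length `r`, transmit power `p` and path loss
exponent `α`, where `c` is the received power times the Laplace variable; `κ` is the product of the
Laplace variable and the directivity gain. -/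
noncomputable def avgLoss (N : ℕ) (ρ κ α p r : ℝ) : ℝ≥0∞ :=
  if p * r ^ (-α) < ρ then ENNReal.ofReal (F N (κ * (p * r ^ (-α)) / N)) else 0

lemma measurable_avgLoss (N : ℕ) (ρ κ α : ℝ) :
    Measurable fun t : ℝ × ℝ => avgLoss N ρ κ α t.1 t.2 := by
  refine Measurable.ite (measurableSet_lt (by fun_prop) measurable_const) ?_ measurable_const
  unfold F
  fun_prop

open Classical in
lemma lintegral_fading {N : ℕ} (hN : 0 < N) {s p g r : ℝ} (ρ α : ℝ) (hs : 0 ≤ s) (hp : 0 ≤ p)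
    (hg : 0 ≤ g) (hr : 0 ≤ r) :
    ∫⁻ f, (1 - eneg (ENNReal.ofReal s * if p * r ^ (-α) < ρ then
      ENNReal.ofReal (p * g * f * r ^ (-α)) else 0)) ∂(gammaMeasure N N) =
      avgLoss N ρ (s * g) α p r := by
  unfold avgLoss
  split_ifs with h
  · have hr' := Real.rpow_nonneg hr (-α)
    rw [← lintegral_one_sub_eneg_gammaMeasure hN (by positivity)]
    refine lintegral_congr fun f => ?_
    rw [← ENNReal.ofReal_mul hs]
    ring_nf
  · simp

namespace Network

variable {K : ℕ} (net : Network K)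

lemma a_pos (j : Fin K) (v : Fin 4) : 0 < net.a j v := by
  have h1 := net.GbMax_pos j
  have h2 := net.GbMin_pos j
  have h3 := net.GuMax_pos
  have h4 := net.GuMin_pos
  fin_cases v <;> simp [a] <;> positivity

lemma b_nonneg (j : Fin K) (v : Fin 4) : 0 ≤ net.b j v := by
  have hπ : 0 < 2 * Real.pi := by positivity
  have h1 := div_nonneg (net.ζr_mem j).1 hπ.le
  have h2 := div_nonneg net.ζt_mem.1 hπ.le
  have h3 := sub_nonneg.2 ((div_le_one hπ).2 (net.ζr_mem j).2)
  have h4 := sub_nonneg.2 ((div_le_one hπ).2 net.ζt_mem.2)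
  have h5 := (net.ζr_mem j).1
  have h6 := net.ζt_mem.1
  fin_cases v <;> simp only [b, Fin.zero_eta, Fin.mk_one, Fin.reduceFinMk, Matrix.cons_val] <;>
    positivity

lemma lintegral_gainLaw (j : Fin K) {f : ℝ → ℝ≥0∞} (hf : Measurable f) :
    ∫⁻ g, f g ∂(net.gainLaw j) = ∑ v, ENNReal.ofReal (net.b j v) * f (net.a j v) := by
  rw [gainLaw, lintegral_finsetSum_measure]
  simp [lintegral_smul_measure, lintegral_dirac' _ hf]

/-- Average over all marks but the transmit power. -/
lemma lintegral_marks_of_power (j k : Fin K) {s p : ℝ} (hs : 0 ≤ s) (hp : 0 ≤ p) (x : Plane) :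
    ∫⁻ g, ∫⁻ u, ∫⁻ f, (1 - eneg (ENNReal.ofReal s * contribution net j k (x, p, g, u, f)))
      ∂net.fadingLaw ∂uniformLaw ∂(net.gainLaw j) =
      ∑ v, ENNReal.ofReal (net.b j v) *
        (ENNReal.ofReal (Real.exp (-net.β j * ‖x‖)) *
          avgLoss net.N (net.ρ k) (s * net.a j v) (net.αL j) p ‖x‖ +
        ENNReal.ofReal (1 - Real.exp (-net.β j * ‖x‖)) *
          avgLoss net.N (net.ρ k) (s * net.a j v) (net.αN j) p ‖x‖) := by
  classical
  have hN' : (0 : ℝ) < net.N := by exact_mod_cast net.N_pos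
  have : IsProbabilityMeasure net.fadingLaw := isProbabilityMeasure_gammaMeasure hN' hN'
  have : SFinite uniformLaw := by unfold uniformLaw; infer_instance
  have hm : Measurable fun t : (ℝ × ℝ) × ℝ =>
      1 - eneg (ENNReal.ofReal s * contribution net j k (x, p, t.1.1, t.1.2, t.2)) :=
    measurable_const.sub (measurable_eneg.comp
      (((measurable_contribution net j k).comp (by fun_prop)).const_mul _))
  have hm2 : Measurable fun g => ∫⁻ u, ∫⁻ f,
      (1 - eneg (ENNReal.ofReal s * contribution net j k (x, p, g, u, f)))
        ∂net.fadingLaw ∂uniformLaw :=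
    (hm.lintegral_prod_right' (ν := net.fadingLaw)).lintegral_prod_right' (ν := uniformLaw)
  rw [net.lintegral_gainLaw j hm2]
  refine Finset.sum_congr rfl fun v _ => ?_
  congr 1
  rw [← lintegral_uniformLaw_isLOS (net.β_pos j) (norm_nonneg x)]
  refine lintegral_congr fun u => ?_
  have hfad := fun α => lintegral_fading net.N_pos (net.ρ k) α hs hp (net.a_pos j v).le
    (norm_nonneg x)
  by_cases hu : IsLOS (net.β j) ‖x‖ u
  · simp only [contribution, hu, if_true]
    exact hfad (net.αL j)
  · simp only [contribution, hu, if_false]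
    exact hfad (net.αN j)

end Network

/-! ### Change of variables in the radial integral -/

lemma lintegral_comp_mul_left_Ioi {c : ℝ} (hc : 0 < c) (g : ℝ → ℝ≥0∞) :
    ∫⁻ r in Set.Ioi (0 : ℝ), g r = ENNReal.ofReal c * ∫⁻ y in Set.Ioi (0 : ℝ), g (c * y) := by
  have himg : (fun y => c * y) '' Set.Ioi (0 : ℝ) = Set.Ioi 0 := by
    rw [Set.image_mul_left_Ioi hc, mul_zero]
  have h := lintegral_image_eq_lintegral_abs_deriv_mul (s := Set.Ioi (0 : ℝ)) (f := fun y => c * y)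
    (f' := fun _ => c) measurableSet_Ioi
    (fun y _ => by simpa using ((hasDerivAt_id y).const_mul c).hasDerivWithinAt)
    (mul_right_injective₀ hc.ne').injOn g
  rw [himg] at h
  rw [h, abs_of_pos hc, lintegral_const_mul' _ _ ENNReal.ofReal_ne_top]

/-- The substitution `r = (q p) ^ (1 / α) * y` for a fixed transmit power `p`. -/
lemma lintegral_radial_subst {N : ℕ} {ρ q α p : ℝ} (hρ : 0 < ρ) (hq : 0 < q) (hα : 0 < α)
    (hp : 0 < p) {w : ℝ → ℝ} (hw : ∀ r, 0 ≤ r → 0 ≤ w r) :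
    ∫⁻ r in Set.Ioi (0 : ℝ), ENNReal.ofReal r * (ENNReal.ofReal (w r) * avgLoss N ρ q α p r) =
      ENNReal.ofReal (q ^ (2 / α)) * ∫⁻ y in Set.Ioi ((q * ρ) ^ (-(1 / α))),
        ENNReal.ofReal (F N (y ^ (-α) / N) * w ((q * p) ^ (1 / α) * y) * y * p ^ (2 / α)) := by
  have hqp := mul_pos hq hp
  have hc : 0 < (q * p) ^ (1 / α) := Real.rpow_pos_of_pos hqp _
  have hlow : 0 < (q * ρ) ^ (-(1 / α)) := Real.rpow_pos_of_pos (mul_pos hq hρ) _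
  rw [lintegral_comp_mul_left_Ioi hc, ← lintegral_const_mul' _ _ ENNReal.ofReal_ne_top,
    ← lintegral_const_mul' _ _ ENNReal.ofReal_ne_top, ← lintegral_indicator measurableSet_Ioi,
    ← lintegral_indicator measurableSet_Ioi]
  refine lintegral_congr fun y => ?_
  by_cases hy : 0 < y
  swap
  · rw [Set.indicator_of_notMem (by simpa using hy), Set.indicator_of_notMem]
    simp only [Set.mem_Ioi, not_lt] at hy ⊢
    exact hy.trans hlow.le
  have hyα : 0 < y ^ (-α) := Real.rpow_pos_of_pos hy _
  have hpow : p * ((q * p) ^ (1 / α) * y) ^ (-α) = y ^ (-α) / q := by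
    rw [Real.mul_rpow hc.le hy.le, ← Real.rpow_mul hqp.le, show 1 / α * -α = -1 by field_simp,
      Real.rpow_neg_one]
    field_simp
  have hcond : y ^ (-α) / q < ρ ↔ (q * ρ) ^ (-(1 / α)) < y := by
    have hl : ((q * ρ) ^ (-(1 / α))) ^ (-α) = q * ρ := by
      rw [← Real.rpow_mul (by positivity), show -(1 / α) * -α = 1 by field_simp, Real.rpow_one]
    rw [div_lt_iff₀ hq, mul_comm ρ q, ← Real.rpow_lt_rpow_iff_of_neg hy hlow (neg_lt_zero.2 hα), hl]
  rw [Set.indicator_of_mem (Set.mem_Ioi.2 hy)]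
  simp only [avgLoss, hpow, hcond]
  by_cases h : (q * ρ) ^ (-(1 / α)) < y
  · rw [Set.indicator_of_mem (Set.mem_Ioi.2 h), if_pos h, mul_div_cancel₀ _ hq.ne',
      ← ENNReal.ofReal_mul (hw _ (by positivity)), ← ENNReal.ofReal_mul (by positivity),
      ← ENNReal.ofReal_mul (by positivity), ← ENNReal.ofReal_mul (by positivity)]
    congr 1
    have h2 : q ^ (2 / α) * p ^ (2 / α) = (q * p) ^ (1 / α) * (q * p) ^ (1 / α) := by
      rw [← Real.mul_rpow hq.le hp.le, ← Real.rpow_add hqp]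
      congr 1; ring
    linear_combination (-(F N (y ^ (-α) / N) * w ((q * p) ^ (1 / α) * y) * y)) * h2
  · rw [Set.indicator_of_notMem (by simpa using h), if_neg h]
    simp

/-- The average over position and transmit power for links of exponent `α` that are present at
distance `r` with probability `w r`. -/
lemma lintegral_radial_power {N : ℕ} {ρ q α Pu : ℝ} (hρ : 0 < ρ) (hq : 0 < q) (hα : 0 < α)
    {w : ℝ → ℝ} (hw : ∀ r, 0 ≤ r → 0 ≤ w r) (hwm : Measurable w) {d : ℝ → ℝ} (hd : Measurable d)
    (hd0 : ∀ p, 0 < p → 0 ≤ d p) :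
    ∫⁻ r in Set.Ioi (0 : ℝ), ENNReal.ofReal r * ∫⁻ p in Set.Ioc 0 Pu,
      ENNReal.ofReal (d p) * (ENNReal.ofReal (w r) * avgLoss N ρ q α p r) =
      ENNReal.ofReal (q ^ (2 / α)) * ∫⁻ y in Set.Ioi ((q * ρ) ^ (-(1 / α))), ∫⁻ p in Set.Ioc 0 Pu,
        ENNReal.ofReal (F N (y ^ (-α) / N) * w ((q * p) ^ (1 / α) * y) * y * p ^ (2 / α) * d p) := by
  have hm1 : Measurable fun t : ℝ × ℝ => ENNReal.ofReal t.1 *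
      (ENNReal.ofReal (d t.2) * (ENNReal.ofReal (w t.1) * avgLoss N ρ q α t.2 t.1)) := by
    have := (measurable_avgLoss N ρ q α).comp (measurable_snd.prodMk
      (measurable_fst (α := ℝ) (β := ℝ)))
    exact (by fun_prop : Measurable fun t : ℝ × ℝ => ENNReal.ofReal t.1).mul
      ((by fun_prop : Measurable fun t : ℝ × ℝ => ENNReal.ofReal (d t.2)).mul
        ((by fun_prop : Measurable fun t : ℝ × ℝ => ENNReal.ofReal (w t.1)).mul this))
  have hm2 : Measurable fun t : ℝ × ℝ => ENNReal.ofReal (F N (t.1 ^ (-α) / N) *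
      w ((q * t.2) ^ (1 / α) * t.1) * t.1 * t.2 ^ (2 / α) * d t.2) := by
    unfold F
    fun_prop
  have h0 : ∀ r : ℝ, ENNReal.ofReal r * ∫⁻ p in Set.Ioc 0 Pu,
      ENNReal.ofReal (d p) * (ENNReal.ofReal (w r) * avgLoss N ρ q α p r) =
      ∫⁻ p in Set.Ioc 0 Pu, ENNReal.ofReal r *
        (ENNReal.ofReal (d p) * (ENNReal.ofReal (w r) * avgLoss N ρ q α p r)) := fun r =>
    (lintegral_const_mul' _ _ ENNReal.ofReal_ne_top).symm
  simp_rw [h0]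
  rw [lintegral_lintegral_swap hm1.aemeasurable, lintegral_lintegral_swap (f := fun y p => ENNReal.ofReal
    (F N (y ^ (-α) / N) * w ((q * p) ^ (1 / α) * y) * y * p ^ (2 / α) * d p)) hm2.aemeasurable,
    ← lintegral_const_mul' _ _ ENNReal.ofReal_ne_top]
  refine setLIntegral_congr_fun measurableSet_Ioc fun p hp => ?_
  have hlow : 0 < (q * ρ) ^ (-(1 / α)) := Real.rpow_pos_of_pos (mul_pos hq hρ) _
  have hdp := hd0 p hp.1
  have h1 : ∀ r : ℝ, ENNReal.ofReal r *
      (ENNReal.ofReal (d p) * (ENNReal.ofReal (w r) * avgLoss N ρ q α p r)) =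
      ENNReal.ofReal (d p) * (ENNReal.ofReal r * (ENNReal.ofReal (w r) * avgLoss N ρ q α p r)) :=
    fun r => by ring
  simp_rw [h1]
  rw [lintegral_const_mul' _ _ ENNReal.ofReal_ne_top, lintegral_radial_subst hρ hq hα hp.1 hw,
    mul_left_comm, ← lintegral_const_mul' _ _ ENNReal.ofReal_ne_top]
  congr 1
  refine lintegral_congr fun y => ?_
  rw [mul_comm, ← ENNReal.ofReal_mul' hdp]

namespace Network

variable {K : ℕ} (net : Network K)

lemma laplaceScale_pos {n : ℕ} (hn : 0 < n) (j : Fin K) :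
    0 < eta net.N * n * net.θ j / (net.ρ j * net.G j) := by
  have h1 := eta_pos net.N_pos
  have h2 := net.θ_pos j
  have h3 := net.ρ_pos j
  have h4 : 0 < net.G j := mul_pos (net.GbMax_pos j) net.GuMax_pos
  positivity

lemma q_eq (n : ℕ) (j : Fin K) (v : Fin 4) :
    net.q n j v = eta net.N * n * net.θ j / (net.ρ j * net.G j) * net.a j v := by
  rw [q]; ring

lemma q_pos {n : ℕ} (hn : 0 < n) (j : Fin K) (v : Fin 4) : 0 < net.q n j v := by
  rw [q_eq]; exact mul_pos (net.laplaceScale_pos hn j) (net.a_pos j v)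

lemma lower_eq (n : ℕ) (j k : Fin K) (v : Fin 4) (α : ℝ) :
    net.lower n j k v α = (net.q n j v * net.ρ k) ^ (-(1 / α)) := by
  rw [lower, q]; congr 1; ring

/-- The mean of `1 - exp (-s c)`, for the contribution `c` of a tier-`k` user with power density
`powerPDF`, integrated over its position. -/
theorem lintegral_contribution_eq {n : ℕ} (hn : 0 < n) (j k : Fin K) :
    ∫⁻ x, ∫⁻ t, (1 - eneg (ENNReal.ofReal (eta net.N * n * net.θ j / (net.ρ j * net.G j)) *
      contribution net j k (x, t)))
      ∂(((volume.restrict (Set.Ioc 0 net.Pu)).withDensity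
        fun p => ENNReal.ofReal (net.powerPDF k p)).prod
          ((net.gainLaw j).prod (uniformLaw.prod net.fadingLaw)))
      ∂(ENNReal.ofReal (net.lam k) • volume) = net.Q n j k + net.V n j k := by
  set s := eta net.N * n * net.θ j / (net.ρ j * net.G j) with hs
  have hs0 : 0 < s := net.laplaceScale_pos hn j
  have hN' : (0 : ℝ) < net.N := by exact_mod_cast net.N_pos
  have hf : IsProbabilityMeasure net.fadingLaw := isProbabilityMeasure_gammaMeasure hN' hN'
  have hu : SFinite uniformLaw := by unfold uniformLaw; infer_instance
  have hg : SFinite (net.gainLaw j) := by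
    rw [gainLaw, ← Measure.sum_fintype]; infer_instance
  have hd := net.measurable_powerPDF k
  have hβ := net.β_pos j
  let A : ℝ → Fin 4 → ℝ → ℝ → ℝ≥0∞ := fun α v p r =>
    avgLoss net.N (net.ρ k) (s * net.a j v) α p r
  let wL : ℝ → ℝ := fun r => Real.exp (-net.β j * r)
  let wN : ℝ → ℝ := fun r => 1 - Real.exp (-net.β j * r)
  have hwL : ∀ r, 0 ≤ r → 0 ≤ wL r := fun r _ => Real.exp_nonneg _
  have hwN : ∀ r, 0 ≤ r → 0 ≤ wN r := fun r hr => one_sub_exp_nonneg hβ hr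
  have hwLm : Measurable wL := by fun_prop
  have hwNm : Measurable wN := by fun_prop
  -- The term of the directivity gain `v`, for links that are present at distance `r` with probability
  -- `w r`.
  let I : (ℝ → ℝ) → ℝ → Fin 4 → ℝ → ℝ≥0∞ := fun w α v r =>
    ∫⁻ p in Set.Ioc 0 net.Pu, ENNReal.ofReal (net.powerPDF k p) *
      (ENNReal.ofReal (w r) * A α v p r)
  have hAm : ∀ α v, Measurable fun t : ℝ × ℝ => A α v t.1 t.2 := fun α v =>
    measurable_avgLoss net.N (net.ρ k) (s * net.a j v) α
  have hAm' : ∀ α v r, Measurable fun p => A α v p r := fun α v r =>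
    (hAm α v).comp (measurable_id.prodMk measurable_const)
  have hIm : ∀ {w : ℝ → ℝ}, Measurable w → ∀ α v, Measurable (I w α v) := fun {w} hw α v => by
    have h1 := (hAm α v).comp (measurable_snd.prodMk (measurable_fst (α := ℝ) (β := ℝ)))
    have h2 : Measurable fun t : ℝ × ℝ => ENNReal.ofReal (net.powerPDF k t.2) *
        (ENNReal.ofReal (w t.1) * A α v t.2 t.1) :=
      (by fun_prop : Measurable fun t : ℝ × ℝ => ENNReal.ofReal (net.powerPDF k t.2)).mul
        ((by fun_prop : Measurable fun t : ℝ × ℝ => ENNReal.ofReal (w t.1)).mul h1)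
    exact h2.lintegral_prod_right'
  have hmarks : ∀ x : Plane, ∫⁻ t, (1 - eneg (ENNReal.ofReal s * contribution net j k (x, t)))
      ∂(((volume.restrict (Set.Ioc 0 net.Pu)).withDensity
        fun p => ENNReal.ofReal (net.powerPDF k p)).prod
          ((net.gainLaw j).prod (uniformLaw.prod net.fadingLaw))) =
      ∑ v, ENNReal.ofReal (net.b j v) * (I wL (net.αL j) v ‖x‖ + I wN (net.αN j) v ‖x‖) := by
    intro x
    have hm : Measurable fun t : ℝ × ℝ × ℝ × ℝ =>
        1 - eneg (ENNReal.ofReal s * contribution net j k (x, t)) :=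
      measurable_const.sub (measurable_eneg.comp
        (((measurable_contribution net j k).comp (by fun_prop)).const_mul _))
    have hm1 : ∀ p, Measurable fun t : ℝ × ℝ × ℝ =>
        1 - eneg (ENNReal.ofReal s * contribution net j k (x, p, t)) := fun p =>
      hm.comp (measurable_const.prodMk measurable_id)
    have hm2 : ∀ p g, Measurable fun t : ℝ × ℝ =>
        1 - eneg (ENNReal.ofReal s * contribution net j k (x, p, g, t)) := fun p g =>
      (hm1 p).comp (measurable_const.prodMk measurable_id)
    rw [lintegral_prod _ hm.aemeasurable,
      lintegral_withDensity_eq_lintegral_mul _ (by fun_prop) hm.lintegral_prod_right']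
    have hterm : ∀ v, Measurable fun p => ENNReal.ofReal (net.b j v) *
        (ENNReal.ofReal (net.powerPDF k p) * (ENNReal.ofReal (wL ‖x‖) * A (net.αL j) v p ‖x‖) +
        ENNReal.ofReal (net.powerPDF k p) * (ENNReal.ofReal (wN ‖x‖) * A (net.αN j) v p ‖x‖)) :=
      fun v => by
        have h1 := hAm' (net.αL j) v ‖x‖
        have h2 := hAm' (net.αN j) v ‖x‖
        fun_prop
    calc _ = ∫⁻ p in Set.Ioc 0 net.Pu, ∑ v, ENNReal.ofReal (net.b j v) *
        (ENNReal.ofReal (net.powerPDF k p) * (ENNReal.ofReal (wL ‖x‖) * A (net.αL j) v p ‖x‖) +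
        ENNReal.ofReal (net.powerPDF k p) * (ENNReal.ofReal (wN ‖x‖) * A (net.αN j) v p ‖x‖)) := by
          refine setLIntegral_congr_fun measurableSet_Ioc fun p hp => ?_
          simp only [Pi.mul_apply]
          rw [lintegral_prod _ (hm1 p).aemeasurable]
          have h3 : ∀ g, ∫⁻ t, (1 - eneg (ENNReal.ofReal s * contribution net j k (x, p, g, t)))
              ∂(uniformLaw.prod net.fadingLaw) = ∫⁻ u, ∫⁻ f,
              (1 - eneg (ENNReal.ofReal s * contribution net j k (x, p, g, u, f)))
                ∂net.fadingLaw ∂uniformLaw := fun g => lintegral_prod _ (hm2 p g).aemeasurable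
          simp_rw [h3]
          rw [net.lintegral_marks_of_power j k hs0.le hp.1.le x, Finset.mul_sum]
          refine Finset.sum_congr rfl fun v _ => ?_
          simp only [A, wL, wN]
          ring
      _ = _ := by
          rw [lintegral_finsetSum _ fun v _ => hterm v]
          refine Finset.sum_congr rfl fun v _ => ?_
          rw [lintegral_const_mul' _ _ ENNReal.ofReal_ne_top, lintegral_add_left]
          have h1 := hAm' (net.αL j) v ‖x‖
          fun_prop
  have hrad : ∀ {w : ℝ → ℝ}, Measurable w → (∀ r, 0 ≤ r → 0 ≤ w r) → ∀ {α}, 0 < α → ∀ v,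
      ∫⁻ r in Set.Ioi (0 : ℝ), ENNReal.ofReal r * I w α v r =
        ENNReal.ofReal (net.q n j v ^ (2 / α)) * ∫⁻ y in Set.Ioi (net.lower n j k v α),
          ∫⁻ p in Set.Ioc 0 net.Pu, ENNReal.ofReal (F net.N (y ^ (-α) / net.N) *
            w ((net.q n j v * p) ^ (1 / α) * y) * y * p ^ (2 / α) * net.powerPDF k p) := by
    intro w hwm hw α hα v
    rw [lower_eq, ← lintegral_radial_power (net.ρ_pos k) (net.q_pos hn j v) hα hw hwm hd
      fun p hp => net.powerPDF_nonneg k hp]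
    simp only [I, A, q_eq, hs]
  have hIL := fun v => hIm hwLm (net.αL j) v
  have hIN := fun v => hIm hwNm (net.αN j) v
  simp_rw [hmarks]
  rw [lintegral_smul_measure, smul_eq_mul, lintegral_norm_plane (f := fun r => ∑ v,
    ENNReal.ofReal (net.b j v) * (I wL (net.αL j) v r + I wN (net.αN j) v r)) (by fun_prop)]
  have hsum : ∫⁻ r in Set.Ioi (0 : ℝ), ENNReal.ofReal r * ∑ v,
      ENNReal.ofReal (net.b j v) * (I wL (net.αL j) v r + I wN (net.αN j) v r) =
      ∑ v, ENNReal.ofReal (net.b j v) *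
        ((∫⁻ r in Set.Ioi (0 : ℝ), ENNReal.ofReal r * I wL (net.αL j) v r) +
        ∫⁻ r in Set.Ioi (0 : ℝ), ENNReal.ofReal r * I wN (net.αN j) v r) := by
    have h1 : ∀ r : ℝ, ENNReal.ofReal r * ∑ v,
        ENNReal.ofReal (net.b j v) * (I wL (net.αL j) v r + I wN (net.αN j) v r) =
        ∑ v, ENNReal.ofReal (net.b j v) *
          (ENNReal.ofReal r * I wL (net.αL j) v r + ENNReal.ofReal r * I wN (net.αN j) v r) :=
      fun r => by
        rw [Finset.mul_sum]
        exact Finset.sum_congr rfl fun v _ => by ring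
    simp_rw [h1]
    rw [lintegral_finsetSum _ fun v _ => by have := hIL v; have := hIN v; fun_prop]
    refine Finset.sum_congr rfl fun v _ => ?_
    rw [lintegral_const_mul' _ _ ENNReal.ofReal_ne_top, lintegral_add_left]
    have := hIL v
    fun_prop
  rw [hsum, ← mul_assoc, ← ENNReal.ofReal_mul (net.lam_pos k).le, Q, V, ← mul_add,
    ← Finset.sum_add_distrib, mul_comm (net.lam k)]
  congr 1
  refine Finset.sum_congr rfl fun v _ => ?_
  rw [hrad hwLm hwL (net.αL_pos j), hrad hwNm hwN (net.αN_pos j), mul_add, ← mul_assoc, ← mul_assoc,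
    ← ENNReal.ofReal_mul (net.b_nonneg j v), ← ENNReal.ofReal_mul (net.b_nonneg j v)]
  simp only [wL, wN, mul_assoc]

end Network

/-! ### The outage probability -/

lemma one_sub_pow_eq (N : ℕ) (z : ℝ) :
    (1 - z) ^ N = 1 - ∑ n ∈ Finset.Icc 1 N, (-1 : ℝ) ^ (n + 1) * (N.choose n : ℝ) * z ^ n := by
  rw [sub_eq_neg_add, add_pow, Finset.range_eq_Ico, Finset.sum_eq_sum_Ico_succ_bot (by omega),
    show Finset.Ico (0 + 1) (N + 1) = Finset.Icc 1 N by ext; simp, sub_eq_add_neg,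
    ← Finset.sum_neg_distrib]
  simp only [pow_zero, one_pow, mul_one, Nat.choose_zero_right, Nat.cast_one]
  congr 1
  refine Finset.sum_congr rfl fun n _ => ?_
  rw [neg_pow, pow_succ]
  ring

namespace Uplink

variable {K : ℕ} {Ω : Type*} [MeasurableSpace Ω] {up : Uplink K Ω} {net : Network K} {j : Fin K}
  {P : Measure Ω} {pl : Fin K → Measure ℝ}

lemma IsModel.measurable_noise (h : up.IsModel net j pl P) :
    Measurable (up.noiseInterference net j) :=
  measurable_noiseInterference (fun k i => (h.loc_ppp k).measurable i) fun k i =>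
    (h.pow_meas k i).prodMk ((h.dir_meas k i).prodMk ((h.blk_meas k i).prodMk (h.fad_meas k i)))

lemma measurable_approxFadingCDF (N : ℕ) : Measurable (approxFadingCDF N) := by
  have : approxFadingCDF N = fun x =>
      (1 - (eneg (ENNReal.ofReal (eta N) * x)).toReal) ^ N := by
    ext x; rw [approxFadingCDF, toReal_eneg]
  rw [this]
  fun_prop

theorem IsModel.approxOutage_eq [IsProbabilityMeasure P]
    (h : up.IsModel net j (fun k => (volume.restrict (Set.Ioc 0 net.Pu)).withDensity
      fun p => ENNReal.ofReal (net.powerPDF k p)) P) :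
    up.approxOutage net j P = net.outageFormula j := by
  have hη := eta_pos net.N_pos
  have hG : 0 < net.ρ j * net.G j :=
    mul_pos (net.ρ_pos j) (mul_pos (net.GbMax_pos j) net.GuMax_pos)
  have hW := h.measurable_noise
  let z : ℕ → Ω → ℝ≥0∞ := fun n ω =>
    eneg (ENNReal.ofReal (eta net.N * n * net.θ j / (net.ρ j * net.G j)) *
      up.noiseInterference net j ω)
  have hz : ∀ n, Measurable (z n) := fun n => measurable_eneg.comp (hW.const_mul _)
  have hint : ∀ n, Integrable (fun ω => (z n ω).toReal) P := fun n =>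
    Integrable.of_bound (hz n).ennreal_toReal.aestronglyMeasurable 1 (ae_of_all _ fun ω => by
      rw [Real.norm_of_nonneg ENNReal.toReal_nonneg]
      exact ENNReal.toReal_le_of_le_ofReal zero_le_one (by simpa using eneg_le_one _))
  have hpt : ∀ ω, approxFadingCDF net.N
      (ENNReal.ofReal (net.θ j / (net.ρ j * net.G j)) * up.noiseInterference net j ω) =
      1 - ∑ n ∈ Finset.Icc 1 net.N, (-1 : ℝ) ^ (n + 1) * (net.N.choose n : ℝ) *
        (z n ω).toReal := fun ω => by
    rw [approxFadingCDF, one_sub_pow_eq]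
    congr 1
    refine Finset.sum_congr rfl fun n _ => ?_
    congr 1
    rw [← toReal_eneg, ← ENNReal.toReal_pow, ← eneg_mul_natCast]
    simp only [z]
    rw [← mul_assoc, ← ENNReal.ofReal_mul hη.le, mul_right_comm, ← ENNReal.ofReal_natCast,
      ← ENNReal.ofReal_mul' (by positivity)]
    congr 4
    ring
  rw [approxOutage, Network.outageFormula]
  simp_rw [hpt]
  rw [integral_sub (integrable_const _) (integrable_finsetSum _ fun n _ => (hint n).const_mul _),
    integral_finsetSum _ fun n _ => (hint n).const_mul _]
  simp only [integral_const, probReal_univ, one_smul]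
  congr 1
  refine Finset.sum_congr rfl fun n hn => ?_
  have hn0 : 0 < n := (Finset.mem_Icc.1 hn).1
  rw [integral_const_mul, integral_toReal (hz n).aemeasurable
    (ae_of_all _ fun ω => (eneg_le_one _).trans_lt ENNReal.one_lt_top)]
  congr 1
  rw [← toReal_eneg]
  congr 1
  simp only [z]
  rw [h.lintegral_eneg_noiseInterference]
  simp_rw [net.lintegral_contribution_eq hn0 j]
  rw [← ENNReal.ofReal_mul (net.laplaceScale_pos hn0 j).le]
  congr 3
  ring

/-- Conditioning the outage probability on noise plus interference. -/
theorem IsModel.measure_outage [IsProbabilityMeasure P] (h : up.IsModel net j pl P) :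
    P {ω | up.sinr net j ω ≤ ENNReal.ofReal (net.θ j)} =
      ∫⁻ ω, net.fadingLaw {g | ENNReal.ofReal g ≤
        ENNReal.ofReal (net.θ j / (net.ρ j * net.G j)) * up.noiseInterference net j ω} ∂P := by
  have hN' : (0 : ℝ) < net.N := by exact_mod_cast net.N_pos
  have hG : 0 < net.ρ j * net.G j :=
    mul_pos (net.ρ_pos j) (mul_pos (net.GbMax_pos j) net.GuMax_pos)
  have hθ := net.θ_pos j
  let Y : Ω → ℝ≥0∞ := fun ω =>
    ENNReal.ofReal (net.θ j / (net.ρ j * net.G j)) * up.noiseInterference net j ω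
  have hle : ∀ A : Set (ULSource K), ⨆ s ∈ A, up.sigma s ≤ ‹MeasurableSpace Ω› :=
    fun A => iSup₂_le fun s _ => h.sigma_le s
  have hY : Measurable[⨆ s ∈ ({.desired}ᶜ : Set (ULSource K)), up.sigma s] Y := by
    refine Measurable.const_mul ?_ _
    refine @measurable_noiseInterference K Ω up net j (_) (fun k i => ?_) fun k i => ?_
    · exact measurable_iSup_sigma (s := .loc k) (by simp) (comap_loc_le k i)
    · exact measurable_marks (by simp [markSources, Set.subset_def])
  have hX : Measurable[⨆ s ∈ ({.desired} : Set (ULSource K)), up.sigma s] up.desired :=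
    measurable_iSup_sigma (Set.mem_singleton ULSource.desired) le_rfl
  let S : Set (ℝ≥0∞ × ℝ) := {t | ENNReal.ofReal t.2 ≤ t.1}
  have hS : MeasurableSet S := measurableSet_le (by fun_prop) (by fun_prop)
  have hI : Indep (⨆ s ∈ ({.desired}ᶜ : Set (ULSource K)), up.sigma s)
      (⨆ s ∈ ({.desired} : Set (ULSource K)), up.sigma s) P :=
    indep_iSup_of_disjoint h.sigma_le h.indep disjoint_compl_left
  have hSm : Measurable (S.indicator (1 : ℝ≥0∞ × ℝ → ℝ≥0∞)) := measurable_one.indicator hS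
  have key := lintegral_mul_comp_of_indep (hle _) (hle _) hI (Z := fun _ => 1) measurable_const
    hY hX hSm
  simp only [one_mul, h.desired_law] at key
  -- Without noise and interference the SINR is `∞`, unless the desired fading
  -- vanishes and the quotient is `0 / 0 = 0`.
  have hpos : ∀ᵐ ω ∂P, 0 < up.desired ω := by
    have h1 : ∀ᵐ g ∂net.fadingLaw, 0 < g := by
      have : net.fadingLaw (Set.Iic 0) = 0 := by
        rw [Network.fadingLaw, gammaMeasure, withDensity_apply _ measurableSet_Iic,
          ← restrict_Iio_eq_restrict_Iic]
        exact lintegral_gammaPDF_of_nonpos le_rfl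
      rw [ae_iff]
      simpa [Set.Iic] using this
    rw [← h.desired_law] at h1
    exact ae_of_ae_map h.desired_meas.aemeasurable h1
  have hset : {ω | up.sinr net j ω ≤ ENNReal.ofReal (net.θ j)} =ᵐ[P]
      {ω | ENNReal.ofReal (up.desired ω) ≤ Y ω} := by
    filter_upwards [hpos] with ω hω
    refine propext ?_
    change up.sinr net j ω ≤ ENNReal.ofReal (net.θ j) ↔ ENNReal.ofReal (up.desired ω) ≤ Y ω
    have h1 : ENNReal.ofReal (net.ρ j * up.desired ω * net.G j) =
        ENNReal.ofReal (net.ρ j * net.G j) * ENNReal.ofReal (up.desired ω) := by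
      rw [← ENNReal.ofReal_mul hG.le]; ring_nf
    have h2 : Y ω = ENNReal.ofReal (net.θ j) * up.noiseInterference net j ω /
        ENNReal.ofReal (net.ρ j * net.G j) := by
      simp only [Y]
      rw [ENNReal.ofReal_div_of_pos hG, ENNReal.div_eq_inv_mul, ENNReal.div_eq_inv_mul, mul_assoc]
    have hG1 : ENNReal.ofReal (net.ρ j * net.G j) ≠ 0 := by simpa using hG
    rw [h2, ENNReal.le_div_iff_mul_le (Or.inl hG1) (Or.inl ENNReal.ofReal_ne_top), sinr,
      mul_comm (ENNReal.ofReal (up.desired ω)), ← h1]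
    have hnum : 0 < net.ρ j * up.desired ω * net.G j := by
      have := mul_pos hG hω
      linarith
    refine ENNReal.div_le_iff_le_mul (Or.inr ENNReal.ofReal_ne_top) (Or.inr ?_)
    simpa using hθ
  have hmS : MeasurableSet {ω | ENNReal.ofReal (up.desired ω) ≤ Y ω} :=
    measurableSet_le h.desired_meas.ennreal_ofReal (h.measurable_noise.const_mul _)
  rw [measure_congr hset, ← lintegral_indicator_one hmS]
  refine key.trans (lintegral_congr fun ω => ?_)
  rw [← lintegral_indicator_one (measurableSet_le (by fun_prop) measurable_const)]
  rfl

end Uplink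

end MmWave

theorem theorem4 {K : ℕ} (net : MmWave.Network K) (j : Fin K)
    {Ω₀ : Type*} [MeasurableSpace Ω₀] (P₀ : Measure Ω₀) [IsProbabilityMeasure P₀]
    (bs : MmWave.BaseStations K Ω₀) (hbs : bs.IsModel net P₀)
    {Ω : Type*} [MeasurableSpace Ω] (P : Measure Ω) [IsProbabilityMeasure P]
    (up : MmWave.Uplink K Ω) (hup : up.IsModel net j (bs.powerLaw net P₀) P) :
    up.approxOutage net j P = net.outageFormula j ∧
      net.outageFormula j ≤ up.outage net j P ∧
      (net.N = 1 → up.outage net j P = net.outageFormula j) := by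
  rw [funext fun k => hbs.powerLaw_eq k] at hup
  have heq := hup.approxOutage_eq
  have happrox : up.approxOutage net j P = (∫⁻ ω, ENNReal.ofReal (MmWave.approxFadingCDF
      net.N (ENNReal.ofReal (net.θ j / (net.ρ j * net.G j)) * up.noiseInterference net j ω))
        ∂P).toReal :=
    integral_eq_lintegral_of_nonneg_ae (ae_of_all _ fun ω => MmWave.approxFadingCDF_nonneg _ _)
      ((MmWave.Uplink.measurable_approxFadingCDF net.N).comp
        (hup.measurable_noise.const_mul _)).aestronglyMeasurable
  have hout : up.outage net j P = (∫⁻ ω, net.fadingLaw {g | ENNReal.ofReal g ≤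
      ENNReal.ofReal (net.θ j / (net.ρ j * net.G j)) * up.noiseInterference net j ω}
        ∂P).toReal := by
    rw [← hup.measure_outage]; rfl
  refine ⟨heq, ?_, fun hN => ?_⟩
  · rw [← heq, happrox, hout]
    refine ENNReal.toReal_mono ?_ (lintegral_mono fun ω => MmWave.approxFadingCDF_le net.N_pos _)
    rw [← hup.measure_outage]
    exact measure_ne_top _ _
  · rw [← heq, happrox, hout, MmWave.Network.fadingLaw, hN]
    simp_rw [MmWave.approxFadingCDF_one_eq]
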